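/- For positive integers $k_1,\dots,k_r$ and signs $\sigma_1,\dots,\sigma_r\in\{\pm1\}$ with $(k_r,\sigma_r)\neq(1,1)$, let $$T(k_1,\dots,k_r;\sigma_1,\dots,\sigma_r):=2^r\sum_{0<n_1<\cdots<n_r}\frac{\sigma_1^{n_1}\cdots\sigma_r^{n_r}}{(2n_1-1)^{k_1}(2n_2-2)^{k_2}\cdots(2n_r-r)^{k_r}},$$ where the value of the series is the limit, as $N\to\infty$, of the finite sums over $0<n_1<\cdots<n_r\le N$. A bar over $k_j$ indicates $\sigma_j=-1$; the components without a bar have $\sigma_j=1$. For integers $0\le l<r$ and $k\ge 1$, let $$W_l(k,r):=\sum_{\substack{k_1+\cdots+k_r=k\\ k_1,\dots,k_r\ge1}}T(k_1,\dots,k_{l-1},\overline{k_l},k_{l+1},\dots,k_{r-1},\overline{k_r}),$$ where exactly the $l$-th and the $r$-th components are barred (only the $r$-th one if $l=0$). Put $\alpha_n:=(-1)^n\pi^{2n}/(2n+1)!$ for integers $n\ge0$. **Theorem.** Let $m,p\ge1$ and $l\ge0$ be integers. The series defining $T(k_1,\dots,\overline{k_l},\dots,\overline{k_r})$ converges for all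 $r>l$ and all positive integers $k_1,\dots,k_r$, and $$(-1)^m\sum_{j=1}^{p}\alpha_{p-j}\,W_l(2j+2m+l-1,\,2m+l)=(-1)^p\sum_{j=1}^{m}\alpha_{m-j}\,W_l(2j+2p+l-1,\,2p+l).$$ -/

import Mathlib

open Filter Topology

/-- The sum `2^r ∑_{0 < n_1 < ⋯ < n_r ≤ N} ∏_j σ_j^{n_j} / (2 n_j - j)^{k_j}`. The index `j : Fin r`
stands for the position `j + 1`. -/
noncomputable def amtvPartial {r : ℕ} (k : Fin r → ℕ) (σ : Fin r → ℤˣ) (N : ℕ) : ℝ :=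
  2 ^ r * ∑ n ∈ (Fintype.piFinset fun _ : Fin r => Finset.Icc 1 N).filter
      (fun n : Fin r → ℕ => ∀ i j : Fin r, i < j → n i < n j),
    ∏ j : Fin r, (((σ j : ℤ) : ℝ) ^ n j / (2 * (n j : ℝ) - ((j : ℕ) + 1 : ℝ)) ^ k j)

/-- The multiple `T`-value `T(k_1, …, k_r; σ_1, …, σ_r)` with signs `σ_j = ±1`. The series need not
converge absolutely, so its value is the limit of the sums over `n_r ≤ N` as `N → ∞`. -/
noncomputable def amtv {r : ℕ} (k : Fin r → ℕ) (σ : Fin r → ℤˣ) : ℝ :=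
  limUnder atTop (amtvPartial k σ)

/-- The signs with bars exactly on positions `l` and `r`
(only on position `r` if `l = 0` or `l = r`). -/
def barSigns (l r : ℕ) : Fin r → ℤˣ :=
  fun j => if (j : ℕ) + 1 = l ∨ (j : ℕ) + 1 = r then -1 else 1

/-- The weighted sum `W_l(k, r)`: the sum of the values `T(k_1, …, \bar k_l, …, \bar k_r)` over all
positive integers `k_1, …, k_r` with `k_1 + ⋯ + k_r = k`. -/
noncomputable def weightedSum (l k r : ℕ) : ℝ :=
  ∑ c ∈ (Fintype.piFinset fun _ : Fin r => Finset.Icc 1 k).filter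
      (fun c : Fin r → ℕ => ∑ i, c i = k),
    amtv c (barSigns l r)

/-- `α_n = (-1)^n π^{2n} / (2n+1)!`. -/
noncomputable def alphaCoeff (n : ℕ) : ℝ :=
  (-1) ^ n * Real.pi ^ (2 * n) / ((2 * n + 1).factorial : ℝ)

/-! Put `n_j = j + i_j`: the indices become weakly increasing and the denominators become `j + 2
i_j`. With `q = tanh (u/2)`, the sums are then values at `u = ∞` of iterated integrals in the forms
`dq/q = du/sinh u`, `2 dq/(1 - q²) = du` and `-2 dq/(1 + q²) = -du/cosh u`. Summing over all
compositions of `e + r` into `r` parts distributes `e` surplus forms `dq/q` in all possible ways.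
Correcting with powers of `L(u) = log coth (u/2)`, where `L' = -1/sinh u`, moves all of them to the
innermost place (`hasDerivAt_chainFun`): the innermost function is `L^e/e!`, followed by `l` forms
`du` and `r - l` forms `-du/cosh u`.

For `r = 2m + l`, integrating the outer variables first gives `W_l(e + r, r) = ∫_0^∞ Φ_{m,l}(v)
L(v)^e/e! dv` (`weightedSum_eq_integral`). Here `φ(v) = ∫_v^∞ dt/cosh t`, `Φ_{m,1} = φ^{2m}/(2m)!`,
`Φ_{m,0} = -Φ_{m,1}'`, and `Φ_{m,l}` for larger `l` arises by repeated tail integration.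

Both `φ` and `L` are boundary or midline values of the single function `ψ(u) = -i log tanh (u/2)`,
holomorphic for `0 < Im u < π`. On `Im u = π/2` it is `φ`. At `iπ - v` on the upper edge it is `π -
i L(v)` for `v > 0` and `-i L(-v)` for `v < 0`. Hence the imaginary part of `ψ^{2p}/(2p)!` on that
edge vanishes for `v < 0`, and for `v > 0` it is `(-1)^p π ∑ α_{p-j} L^{2j-1}/(2j-1)!`
(`edgePoly_eq`).

So, up to sign and a factor `π`, each side of the identity is the imaginary part of a pairing `∫
Ψ_{m,l}(z + iπ/2) Ψ_{p,1}(iπ - z) dz` along `Im z = ε`, evaluated as `ε → 0` (`im_pairing_eq`),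
where `Ψ` continues `Φ` to the strip. The pairing does not depend on `ε` by Cauchy's theorem, the
reflection `z ↦ iπ/2 - z` exchanges its two functions, and integration by parts moves tail integrals
from one to the other. It is therefore symmetric in `m` and `p` (`pairing_psiTail_symm`). -/

/-! ### Truncated sums and their recursion in the depth -/

theorem sum_strict_tuples_succ {r : ℕ} (N : ℕ) (F : (Fin (r + 1) → ℕ) → ℝ) :
    ∑ n ∈ (Fintype.piFinset fun _ : Fin (r + 1) => Finset.Icc 1 N).filter
        (fun n : Fin (r + 1) → ℕ => ∀ i j : Fin (r + 1), i < j → n i < n j), F n =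
      ∑ m ∈ Finset.Icc 1 N, ∑ n ∈ (Fintype.piFinset fun _ : Fin r => Finset.Icc 1 (m - 1)).filter
        (fun n : Fin r → ℕ => ∀ i j : Fin r, i < j → n i < n j), F (Fin.snoc n m) := by
  rw [Finset.sum_sigma']
  refine Finset.sum_bij' (fun n _ => ⟨n (Fin.last r), Fin.init n⟩) (fun p _ => Fin.snoc p.2 p.1)
    ?_ ?_ ?_ ?_ ?_
  · intro n hn
    simp only [Finset.mem_filter, Fintype.mem_piFinset, Finset.mem_Icc, Finset.mem_sigma] at hn ⊢
    refine ⟨hn.1 _, fun i => ⟨(hn.1 _).1, ?_⟩, fun i j hij => hn.2 _ _ ?_⟩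
    · have := hn.2 i.castSucc (Fin.last r) (Fin.castSucc_lt_last i)
      simp only [Fin.init]
      omega
    · simpa using hij
  · rintro ⟨m, n⟩ hn
    simp only [Finset.mem_filter, Fintype.mem_piFinset, Finset.mem_Icc, Finset.mem_sigma] at hn ⊢
    refine ⟨fun i => ?_, fun i j hij => ?_⟩
    · refine Fin.lastCases ?_ (fun i => ?_) i
      · simpa using hn.1
      · have := hn.2.1 i
        simp only [Fin.snoc_castSucc]
        omega
    · induction j using Fin.lastCases with
      | last =>
        induction i using Fin.lastCases with
        | last => exact absurd hij (lt_irrefl _)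
        | cast i =>
          have := hn.2.1 i
          simp only [Fin.snoc_castSucc, Fin.snoc_last]
          omega
      | cast j =>
        induction i using Fin.lastCases with
        | last => exact absurd hij (not_lt.mpr (Fin.castSucc_lt_last j).le)
        | cast i =>
          simpa using hn.2.2 i j (by simpa using hij)
  · intro n _
    simp
  · rintro ⟨m, n⟩ _
    simp
  · intro n _
    simp

theorem amtvPartial_succ {r : ℕ} (k : Fin (r + 1) → ℕ) (σ : Fin (r + 1) → ℤˣ) (N : ℕ) :
    amtvPartial k σ N = 2 * ∑ m ∈ Finset.Icc 1 N,
      ((σ (Fin.last r) : ℤ) : ℝ) ^ m / (2 * (m : ℝ) - ((r : ℕ) + 1 : ℝ)) ^ k (Fin.last r) *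
        amtvPartial (Fin.init k) (Fin.init σ) (m - 1) := by
  unfold amtvPartial
  rw [sum_strict_tuples_succ, pow_succ', mul_assoc, Finset.mul_sum]
  congr 1
  refine Finset.sum_congr rfl fun m _ => ?_
  rw [mul_left_comm, Finset.mul_sum (a := (_ : ℝ) ^ m / _)]
  congr 1
  refine Finset.sum_congr rfl fun n _ => ?_
  rw [Fin.prod_univ_castSucc, mul_comm]
  simp [Fin.init]

theorem amtvPartial_eq_zero {r : ℕ} (k : Fin r → ℕ) (σ : Fin r → ℤˣ) {N : ℕ} (h : N < r) :
    amtvPartial k σ N = 0 := by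
  induction r generalizing N with
  | zero => omega
  | succ r ih =>
    rw [amtvPartial_succ, Finset.sum_eq_zero, mul_zero]
    intro m hm
    rw [Finset.mem_Icc] at hm
    rw [ih _ _ (by omega), mul_zero]

theorem amtvPartial_zero (k : Fin 0 → ℕ) (σ : Fin 0 → ℤˣ) (N : ℕ) : amtvPartial k σ N = 1 := by
  simp [amtvPartial]

/-- Recursion after the substitution `n_j = j + i_j`. -/
theorem amtvPartial_succ_add {r : ℕ} (k : Fin (r + 1) → ℕ) (σ : Fin (r + 1) → ℤˣ) (M : ℕ) :
    amtvPartial k σ (r + 1 + M) = 2 * ∑ i ∈ Finset.range (M + 1),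
      ((σ (Fin.last r) : ℤ) : ℝ) ^ (r + 1 + i) / ((r : ℝ) + 1 + 2 * i) ^ k (Fin.last r) *
        amtvPartial (Fin.init k) (Fin.init σ) (r + i) := by
  rw [amtvPartial_succ]
  congr 1
  rw [← Finset.sum_filter_add_sum_filter_not _ (fun m => r + 1 ≤ m), add_comm,
    Finset.sum_eq_zero, zero_add]
  · symm
    refine Finset.sum_bij' (fun i _ => r + 1 + i) (fun m _ => m - (r + 1)) ?_ ?_ ?_ ?_ ?_
    · intro i hi
      simp only [Finset.mem_filter, Finset.mem_Icc, Finset.mem_range] at hi ⊢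
      omega
    · intro i hi
      simp only [Finset.mem_filter, Finset.mem_Icc, Finset.mem_range] at hi ⊢
      omega
    · intro i hi
      simp
    · intro i hi
      simp only [Finset.mem_filter, Finset.mem_Icc] at hi
      omega
    · intro i hi
      have h1 : r + 1 + i - 1 = r + i := by omega
      have h2 : 2 * ((r + 1 + i : ℕ) : ℝ) - ((r : ℕ) + 1 : ℝ) = (r : ℝ) + 1 + 2 * i := by
        push_cast; ring
      rw [h1, h2]
  · intro m hm
    simp only [Finset.mem_filter, Finset.mem_Icc, not_le] at hm
    rw [amtvPartial_eq_zero _ _ (by omega), mul_zero]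

/-! ### Growth of the truncated sums and convergence of the series -/

theorem sum_inv_sqrt_le (M : ℕ) :
    ∑ i ∈ Finset.range M, 1 / √((i : ℝ) + 1) ≤ 2 * √(M : ℝ) := by
  induction M with
  | zero => simp
  | succ M ih =>
    rw [Finset.sum_range_succ]
    push_cast
    have h0 : 0 < √((M : ℝ) + 1) := Real.sqrt_pos.mpr (by positivity)
    have h1 : √((M : ℝ) + 1) ^ 2 = M + 1 := Real.sq_sqrt (by positivity)
    have h2 : √(M : ℝ) ^ 2 = M := Real.sq_sqrt (by positivity)
    have h3 : 1 / √((M : ℝ) + 1) ≤ 2 * √((M : ℝ) + 1) - 2 * √(M : ℝ) := by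
      rw [div_le_iff₀ h0]
      nlinarith [sq_nonneg (√((M : ℝ) + 1) - √(M : ℝ))]
    linarith

theorem abs_units_pow (u : ℤˣ) (n : ℕ) : |((u : ℤ) : ℝ) ^ n| = 1 := by
  rcases Int.units_eq_one_or u with h | h <;> simp [h]

theorem abs_amtvPartial_term_le {r : ℕ} (k : ℕ) (hk : 1 ≤ k) (u : ℤˣ) (i n : ℕ) (x C : ℝ)
    (hx : |x| ≤ C * √((i : ℝ) + 1)) :
    |((u : ℤ) : ℝ) ^ n / ((r : ℝ) + 1 + 2 * i) ^ k * x| ≤ C * (1 / √((i : ℝ) + 1)) := by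
  have h0 : 0 < √((i : ℝ) + 1) := Real.sqrt_pos.mpr (by positivity)
  have hC : 0 ≤ C := nonneg_of_mul_nonneg_left ((abs_nonneg x).trans hx) h0
  have h1 : √((i : ℝ) + 1) ^ 2 = i + 1 := Real.sq_sqrt (by positivity)
  have hd : (i : ℝ) + 1 ≤ ((r : ℝ) + 1 + 2 * i) ^ k := by
    refine le_trans ?_ (le_self_pow₀ (by
      linarith [(Nat.cast_nonneg r : (0 : ℝ) ≤ r), (Nat.cast_nonneg i : (0 : ℝ) ≤ i)]) (by omega))
    linarith [(Nat.cast_nonneg r : (0 : ℝ) ≤ r), (Nat.cast_nonneg i : (0 : ℝ) ≤ i)]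
  have hd0 : 0 < (i : ℝ) + 1 := by positivity
  rw [abs_mul, abs_div, abs_units_pow, abs_of_pos (hd0.trans_le hd)]
  calc _ ≤ 1 / ((i : ℝ) + 1) * (C * √((i : ℝ) + 1)) := by gcongr
    _ = C * (1 / √((i : ℝ) + 1)) := by
      rw [← Real.sqrt_div_self']; ring

/-- The true growth is a power of a logarithm. The cruder square root reproduces itself: each new
depth sums terms of size `1/√(i + 1)`, which costs a factor 2 beside the factor 2 in the definition.
-/
theorem abs_amtvPartial_le {r : ℕ} (k : Fin r → ℕ) (hk : ∀ i, 1 ≤ k i) (σ : Fin r → ℤˣ) (M : ℕ) :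
    |amtvPartial k σ (r + M)| ≤ 4 ^ r * √((M : ℝ) + 1) := by
  induction r generalizing M with
  | zero =>
    rw [amtvPartial_zero]
    simp
  | succ r ih =>
    rw [amtvPartial_succ_add, abs_mul, abs_two]
    have h : ∀ i ∈ Finset.range (M + 1), |((σ (Fin.last r) : ℤ) : ℝ) ^ (r + 1 + i) /
        ((r : ℝ) + 1 + 2 * i) ^ k (Fin.last r) *
        amtvPartial (Fin.init k) (Fin.init σ) (r + i)| ≤ 4 ^ r * (1 / √((i : ℝ) + 1)) := fun i _ =>
      abs_amtvPartial_term_le _ (hk _) _ _ _ _ _ (ih _ (fun i => hk _) _ _)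
    have h2 := (Finset.abs_sum_le_sum_abs _ _).trans (Finset.sum_le_sum h)
    rw [← Finset.mul_sum] at h2
    have h3 := sum_inv_sqrt_le (M + 1)
    push_cast at h3
    have h4 : (0 : ℝ) ≤ 4 ^ r := by positivity
    calc _ ≤ 2 * (4 ^ r * (2 * √((M : ℝ) + 1))) := by gcongr; exact h2.trans (by gcongr)
      _ = _ := by ring

/-- Summation by parts: up to boundary terms, twice the alternating sum is the alternating sum of
the differences, which converges absolutely. -/
theorem exists_tendsto_alternating_of_summable_diff (a : ℕ → ℝ) (h0 : Tendsto a atTop (𝓝 0))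
    (h1 : Summable fun n => |a n - a (n + 1)|) :
    ∃ L, Tendsto (fun N => ∑ n ∈ Finset.range N, (-1 : ℝ) ^ n * a n) atTop (𝓝 L) := by
  have h2 : Summable fun n => (-1 : ℝ) ^ n * (a n - a (n + 1)) := by
    refine Summable.of_norm ?_
    simpa [abs_mul] using h1
  have h3 := h2.hasSum.tendsto_sum_nat
  have h4 : ∀ N, ∑ n ∈ Finset.range N, (-1 : ℝ) ^ n * a n =
      (∑ n ∈ Finset.range N, (-1 : ℝ) ^ n * (a n - a (n + 1)) + a 0 - (-1) ^ N * a N) / 2 := by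
    intro N
    induction N with
    | zero => simp
    | succ N ih =>
      rw [Finset.sum_range_succ, Finset.sum_range_succ, ih]
      ring
  have h5 : Tendsto (fun N => (-1 : ℝ) ^ N * a N) atTop (𝓝 0) := by
    rw [tendsto_zero_iff_abs_tendsto_zero] at h0 ⊢
    refine h0.congr fun N => ?_
    simp [abs_mul]
  simp_rw [h4]
  exact ⟨_, (((h3.add_const _).sub h5).div_const _)⟩

theorem abs_pow_inv_sub_le {d : ℝ} (hd : 1 ≤ d) (k : ℕ) :
    |(1 / d) ^ k - (1 / (d + 2)) ^ k| ≤ 2 * k / d ^ 2 := by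
  have hd0 : 0 < d := by linarith
  have h1 : 1 / (d + 2) ≤ 1 / d := by gcongr; linarith
  have h2 : 1 / d ≤ 1 := by rw [div_le_one hd0]; exact hd
  have h3 : 0 < 1 / (d + 2) := by positivity
  have := abs_pow_sub_pow_le (1 / d) (1 / (d + 2)) k
  have h4 : |1 / d - 1 / (d + 2)| ≤ 2 / d ^ 2 := by
    rw [abs_of_nonneg (by linarith), div_sub_div _ _ hd0.ne' (by linarith)]
    rw [div_le_div_iff₀ (by positivity) (by positivity)]
    nlinarith [mul_pos hd0 hd0]
  have h5 : max |1 / d| |1 / (d + 2)| ^ (k - 1) ≤ 1 := by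
    refine pow_le_one₀ (by positivity) (max_le ?_ ?_)
    · rw [abs_of_pos (by positivity)]; exact h2
    · rw [abs_of_pos h3]; exact h1.trans h2
  calc _ ≤ _ := this
    _ ≤ 2 / d ^ 2 * k * 1 := by gcongr
    _ = _ := by ring

theorem summable_inv_mul_sqrt : Summable fun i : ℕ => √((i : ℝ) + 1) / ((i : ℝ) + 1) ^ 2 := by
  have h := (summable_nat_add_iff 1).mpr (Real.summable_nat_rpow_inv.mpr (by norm_num : (1 : ℝ) < 3 / 2))
  refine h.congr fun i => ?_
  have : (0 : ℝ) < (i : ℝ) + 1 := by positivity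
  push_cast
  rw [Real.sqrt_eq_rpow, ← Real.rpow_natCast _ 2, ← Real.rpow_sub this, ← Real.rpow_neg this.le]
  norm_num

/-- The last sign makes the outer sum alternating. Its terms have bounded variation: differencing
the power of the denominator gains `i⁻²` against `√i`, and differencing the inner sum leaves a
single term of size `i^(-1/2)` against `i⁻¹`. -/
theorem tendsto_amtvPartial {r : ℕ} (k : Fin (r + 1) → ℕ) (hk : ∀ i, 1 ≤ k i)
    (σ : Fin (r + 1) → ℤˣ) (hσ : σ (Fin.last r) = -1) :
    Tendsto (amtvPartial k σ) atTop (𝓝 (amtv k σ)) := by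
  suffices h : ∃ L, Tendsto (amtvPartial k σ) atTop (𝓝 L) from tendsto_nhds_limUnder h
  set U : ℕ → ℝ := fun i => amtvPartial (Fin.init k) (Fin.init σ) (r + i) with hU
  set K := k (Fin.last r)
  have hKpos : 1 ≤ K := hk _
  set a : ℕ → ℝ := fun i => (1 / ((r : ℝ) + 1 + 2 * i)) ^ K * U i with ha
  have hUb : ∀ i, |U i| ≤ 4 ^ r * √((i : ℝ) + 1) := fun i =>
    abs_amtvPartial_le _ (fun i => hk _) _ _
  have hr : (0 : ℝ) ≤ r := Nat.cast_nonneg r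
  have hstep : ∀ i, |U i - U (i + 1)| ≤ 4 ^ r * (2 * (1 / √((i : ℝ) + 1))) := by
    intro i
    have hp : 0 < √((i : ℝ) + 1) := Real.sqrt_pos.mpr (by positivity)
    -- In depth 0 the inner sum is constantly 1; otherwise the difference is the last summand of its
    -- recursion.
    rcases r with _ | r
    · simp only [hU, amtvPartial_zero, sub_self, abs_zero]
      positivity
    · have e1 : U i - U (i + 1) = -(2 * (((Fin.init σ (Fin.last r) : ℤ) : ℝ) ^ (r + 1 + (i + 1)) /
          ((r : ℝ) + 1 + 2 * (i + 1 : ℕ)) ^ (Fin.init k (Fin.last r)) *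
          amtvPartial (Fin.init (Fin.init k)) (Fin.init (Fin.init σ)) (r + (i + 1)))) := by
        simp only [hU]
        rw [amtvPartial_succ_add, amtvPartial_succ_add, Finset.sum_range_succ _ (i + 1)]
        ring
      rw [e1, abs_neg, abs_mul, abs_two]
      have h1 := abs_amtvPartial_term_le (r := r) (Fin.init k (Fin.last r)) (hk _)
        (Fin.init σ (Fin.last r)) (i + 1) (r + 1 + (i + 1)) _ _
        (abs_amtvPartial_le (Fin.init (Fin.init k)) (fun i => hk _) (Fin.init (Fin.init σ)) (i + 1))
      have h2 : 1 / √(((i + 1 : ℕ) : ℝ) + 1) ≤ 1 / √((i : ℝ) + 1) := by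
        gcongr
        linarith
      calc _ ≤ 2 * (4 ^ r * (1 / √(((i + 1 : ℕ) : ℝ) + 1))) := by gcongr
        _ ≤ 2 * (4 ^ r * (1 / √((i : ℝ) + 1))) := by gcongr
        _ ≤ 4 ^ r * (4 * (2 * (1 / √((i : ℝ) + 1)))) := by
          have : 0 ≤ 4 ^ r * (1 / √((i : ℝ) + 1)) := by positivity
          linarith
        _ = _ := by ring
  have hd : ∀ i : ℕ, (i : ℝ) + 1 ≤ (r : ℝ) + 1 + 2 * i := fun i => by
    linarith [(Nat.cast_nonneg i : (0 : ℝ) ≤ i)]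
  have hy : ∀ i : ℕ, (1 / ((r : ℝ) + 1 + 2 * i)) ^ K ≤ 1 / ((i : ℝ) + 1) := by
    intro i
    have hp : (0 : ℝ) < (i : ℝ) + 1 := by positivity
    refine (pow_le_of_le_one (by positivity) ?_ (by omega)).trans ?_
    · rw [div_le_one (hp.trans_le (hd i))]
      linarith [(Nat.cast_nonneg i : (0 : ℝ) ≤ i)]
    · exact one_div_le_one_div_of_le hp (hd i)
  have hsq : ∀ i : ℕ, 1 / ((i : ℝ) + 1) * (1 / √((i : ℝ) + 1)) = √((i : ℝ) + 1) / ((i : ℝ) + 1) ^ 2 := by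
    intro i
    rw [← Real.sqrt_div_self', div_mul_div_comm, one_mul, sq]
  have ha0 : Tendsto a atTop (𝓝 0) := by
    have h1 : Tendsto (fun i : ℕ => 4 ^ r * (1 / √((i : ℝ) + 1))) atTop (𝓝 0) := by
      rw [← mul_zero ((4 : ℝ) ^ r)]
      refine Tendsto.const_mul _ ?_
      simp_rw [one_div]
      exact (Real.tendsto_sqrt_atTop.comp (tendsto_natCast_atTop_atTop.atTop_add
        tendsto_const_nhds)).inv_tendsto_atTop
    refine squeeze_zero_norm (fun i => ?_) h1
    have hp : (0 : ℝ) < (i : ℝ) + 1 := by positivity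
    simp only [ha, Real.norm_eq_abs, abs_mul]
    rw [abs_of_nonneg (by positivity), ← Real.sqrt_div_self']
    calc _ ≤ 1 / ((i : ℝ) + 1) * (4 ^ r * √((i : ℝ) + 1)) := by
          gcongr
          · exact hy i
          · exact hUb i
      _ = _ := by ring
  have hsum : Summable fun i => |a i - a (i + 1)| := by
    refine Summable.of_nonneg_of_le (fun i => abs_nonneg _) (fun i => ?_)
      (summable_inv_mul_sqrt.mul_left ((4 : ℝ) ^ r * (2 * (K : ℝ) + 2)))
    have hp : (0 : ℝ) < (i : ℝ) + 1 := by positivity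
    have e : a i - a (i + 1) = ((1 / ((r : ℝ) + 1 + 2 * i)) ^ K -
        (1 / ((r : ℝ) + 1 + 2 * i + 2)) ^ K) * U i +
        (1 / ((r : ℝ) + 1 + 2 * (i + 1 : ℕ))) ^ K * (U i - U (i + 1)) := by
      simp only [ha]
      push_cast
      rw [show (r : ℝ) + 1 + 2 * ((i : ℝ) + 1) = (r : ℝ) + 1 + 2 * i + 2 by ring]
      ring
    rw [e]
    refine (abs_add_le _ _).trans ?_
    rw [abs_mul, abs_mul]
    have h1 : |(1 / ((r : ℝ) + 1 + 2 * i)) ^ K - (1 / ((r : ℝ) + 1 + 2 * i + 2)) ^ K| ≤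
        2 * K / ((i : ℝ) + 1) ^ 2 :=
      (abs_pow_inv_sub_le (by linarith [(Nat.cast_nonneg i : (0 : ℝ) ≤ i)]) K).trans
        (div_le_div_of_nonneg_left (by positivity) (by positivity)
          (pow_le_pow_left₀ hp.le (hd i) 2))
    have h2 : |(1 / ((r : ℝ) + 1 + 2 * (i + 1 : ℕ))) ^ K| ≤ 1 / ((i : ℝ) + 1) := by
      rw [abs_of_nonneg (by positivity)]
      refine (hy (i + 1)).trans ?_
      gcongr
      linarith
    calc _ ≤ 2 * K / ((i : ℝ) + 1) ^ 2 * (4 ^ r * √((i : ℝ) + 1)) +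
          1 / ((i : ℝ) + 1) * (4 ^ r * (2 * (1 / √((i : ℝ) + 1)))) := by
          gcongr
          · exact hUb i
          · exact hstep i
      _ = 2 * K / ((i : ℝ) + 1) ^ 2 * (4 ^ r * √((i : ℝ) + 1)) +
          2 * 4 ^ r * (1 / ((i : ℝ) + 1) * (1 / √((i : ℝ) + 1))) := by ring
      _ = _ := by rw [hsq]; ring
  obtain ⟨L, hL⟩ := exists_tendsto_alternating_of_summable_diff a ha0 hsum
  refine ⟨2 * ((-1) ^ (r + 1) * L), ?_⟩
  rw [← tendsto_add_atTop_iff_nat (r + 1)]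
  have h3 := ((tendsto_add_atTop_iff_nat 1).mpr hL).const_mul ((-1 : ℝ) ^ (r + 1))
  refine (h3.const_mul 2).congr fun M => ?_
  rw [add_comm M (r + 1), amtvPartial_succ_add, Finset.mul_sum]
  congr 1
  refine Finset.sum_congr rfl fun i _ => ?_
  simp only [ha, hU, hσ]
  push_cast
  rw [pow_add, one_div, inv_pow]
  ring

/-! ### Sums over all compositions, indexed by the excess of weight over depth -/

theorem sum_compositions_succ {r : ℕ} (e : ℕ) (F : (Fin (r + 1) → ℕ) → ℝ) :
    ∑ c ∈ (Fintype.piFinset fun _ : Fin (r + 1) => Finset.Icc 1 (e + (r + 1))).filter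
        (fun c : Fin (r + 1) → ℕ => ∑ i, c i = e + (r + 1)), F c =
      ∑ b ∈ Finset.range (e + 1),
        ∑ c ∈ (Fintype.piFinset fun _ : Fin r => Finset.Icc 1 (e - b + r)).filter
          (fun c : Fin r → ℕ => ∑ i, c i = e - b + r), F (Fin.snoc c (b + 1)) := by
  rw [Finset.sum_sigma']
  refine Finset.sum_bij' (fun n _ => ⟨n (Fin.last r) - 1, Fin.init n⟩)
    (fun p _ => Fin.snoc p.2 (p.1 + 1)) ?_ ?_ ?_ ?_ ?_
  · intro n hn
    simp only [Finset.mem_filter, Fintype.mem_piFinset, Finset.mem_Icc, Finset.mem_sigma,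
      Finset.mem_range] at hn ⊢
    obtain ⟨h1, h2⟩ := hn
    rw [Fin.sum_univ_castSucc] at h2
    have h3 := (h1 (Fin.last r)).1
    have h4 : r ≤ ∑ i : Fin r, n i.castSucc := by
      simpa using Finset.card_nsmul_le_sum Finset.univ (fun i : Fin r => n i.castSucc) 1
        (fun i _ => (h1 _).1)
    have h5 : ∑ i : Fin r, Fin.init n i = ∑ i : Fin r, n i.castSucc := rfl
    refine ⟨by omega, fun i => ⟨(h1 _).1, ?_⟩, by omega⟩
    have := Finset.single_le_sum (f := Fin.init n) (fun i _ => Nat.zero_le _) (Finset.mem_univ i)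
    omega
  · rintro ⟨b, n⟩ hn
    simp only [Finset.mem_filter, Fintype.mem_piFinset, Finset.mem_Icc, Finset.mem_sigma,
      Finset.mem_range] at hn ⊢
    refine ⟨fun i => ?_, ?_⟩
    · refine Fin.lastCases ?_ (fun i => ?_) i
      · simp only [Fin.snoc_last]
        omega
      · have := hn.2.1 i
        simp only [Fin.snoc_castSucc]
        omega
    · rw [Fin.sum_univ_castSucc]
      simp only [Fin.snoc_castSucc, Fin.snoc_last]
      omega
  · intro n hn
    simp only [Finset.mem_filter, Fintype.mem_piFinset, Finset.mem_Icc] at hn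
    have := (hn.1 (Fin.last r)).1
    simp [Nat.sub_add_cancel this]
  · rintro ⟨m, n⟩ _
    simp
  · intro n hn
    simp only [Finset.mem_filter, Fintype.mem_piFinset, Finset.mem_Icc] at hn
    have := (hn.1 (Fin.last r)).1
    simp [Nat.sub_add_cancel this]

/-- The sum of the truncated values over all compositions of `e + r` into `r` parts. -/
noncomputable def weightedPartial (s : ℕ → ℤˣ) (r e M : ℕ) : ℝ :=
  ∑ c ∈ (Fintype.piFinset fun _ : Fin r => Finset.Icc 1 (e + r)).filter
    (fun c : Fin r → ℕ => ∑ i, c i = e + r), amtvPartial c (fun j : Fin r => s j) (r + M)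

theorem weightedPartial_zero (s : ℕ → ℤˣ) (e M : ℕ) :
    weightedPartial s 0 e M = if e = 0 then 1 else 0 := by
  unfold weightedPartial
  simp only [amtvPartial_zero, Finset.univ_eq_empty, Finset.sum_empty, add_zero]
  split_ifs with h
  · subst h
    simp
  · rw [Finset.sum_eq_zero]
    intro c hc
    simp only [Finset.mem_filter] at hc
    omega

theorem weightedPartial_succ (s : ℕ → ℤˣ) (r e M : ℕ) :
    weightedPartial s (r + 1) e M = 2 * ∑ i ∈ Finset.range (M + 1),
      ((s r : ℤ) : ℝ) ^ (r + 1 + i) * ∑ b ∈ Finset.range (e + 1),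
        (1 / ((r : ℝ) + 1 + 2 * i)) ^ (b + 1) * weightedPartial s r (e - b) i := by
  unfold weightedPartial
  rw [sum_compositions_succ]
  simp_rw [amtvPartial_succ_add, Fin.init_snoc, Fin.snoc_last]
  simp_rw [← Finset.mul_sum]
  congr 1
  simp_rw [Finset.mul_sum]
  rw [Finset.sum_congr rfl (fun b _ => Finset.sum_comm), Finset.sum_comm]
  refine Finset.sum_congr rfl fun i _ => Finset.sum_congr rfl fun b _ =>
    Finset.sum_congr rfl fun c _ => ?_
  have h1 : (Fin.init fun j : Fin (r + 1) => s j) = fun j : Fin r => s j := rfl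
  rw [h1, Fin.val_last, one_div, inv_pow]
  ring

/-! ### Signs of the levels and coefficients of the generating functions -/

/-- `1` for the positions before `l`, `-1` from position `l` on. -/
def levelSign (l j : ℕ) : ℝ := if j < l then 1 else -1

/-- Coefficients of the generating functions in the odd/even exponents `j + 2 i`. -/
noncomputable def coef (l : ℕ) : ℕ → ℕ → ℕ → ℝ
  | 0, e, i => if e = 0 ∧ i = 0 then 1 else 0
  | j + 1, e, i => 2 * levelSign l j ^ (i + 1) * ∑ b ∈ Finset.range (e + 1),
      (1 / ((j : ℝ) + 1 + 2 * i)) ^ (b + 1) *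
        ∑ i' ∈ Finset.range (i + 1), levelSign l j ^ i' * coef l j (e - b) i'

/-- The signs of `barSigns l r`, indexed by all natural numbers. -/
def barSeq (l r j : ℕ) : ℤˣ := if j + 1 = l ∨ j + 1 = r then -1 else 1

/-- The sign belonging to a level is the product of the signs of its own position and all later
ones: both bars contribute up to position `l`, only the last one afterwards. Consecutive level signs
differ by the sign of one position, and the exponent `i + j` is the original index `n_j`. -/
theorem weightedPartial_barSeq {l r : ℕ} (hlr : l < r) (j e M : ℕ) (hj : j ≤ r) :
    weightedPartial (barSeq l r) j e M =
      ∑ i ∈ Finset.range (M + 1), (if j < l ∨ j = r then (1 : ℝ) else -1) ^ (i + j) * coef l j e i := by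
  induction j generalizing e M with
  | zero =>
    rw [weightedPartial_zero]
    rw [Finset.sum_eq_single 0]
    · simp [coef]
    · intro b _ hb
      simp [coef, hb]
    · simp
  | succ j ih =>
    rw [weightedPartial_succ, Finset.mul_sum]
    refine Finset.sum_congr rfl fun i _ => ?_
    have h1 : (if j < l ∨ j = r then (1 : ℝ) else -1) = levelSign l j := by
      unfold levelSign
      simp [show j ≠ r by omega]
    simp_rw [ih _ _ (by omega : j ≤ r), h1, coef]
    have hsq : levelSign l j * levelSign l j = 1 := by unfold levelSign; split_ifs <;> norm_num
    have h2 : ((barSeq l r j : ℤ) : ℝ) =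
        (if j + 1 < l ∨ j + 1 = r then (1 : ℝ) else -1) * levelSign l j := by
      unfold barSeq levelSign
      split_ifs <;> first | omega | simp
    rw [h2, mul_pow]
    have h3 : levelSign l j ^ (i + 1) = levelSign l j ^ (j + 1 + i) * levelSign l j ^ j := by
      rw [← pow_add, show j + 1 + i + j = 2 * j + (i + 1) by ring, pow_add _ (2 * j), pow_mul, sq, hsq]
      simp
    have h4 : ∀ i', levelSign l j ^ i' * levelSign l j ^ j * levelSign l j ^ j = levelSign l j ^ i' := by
      intro i'
      rw [mul_assoc, ← mul_pow, hsq, one_pow, mul_one]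
    rw [h3]
    simp_rw [Finset.mul_sum]
    refine Finset.sum_congr rfl fun b _ => Finset.sum_congr rfl fun i' _ => ?_
    rw [add_comm i (j + 1), pow_add _ i' j]
    ring

/-- At the full depth `j = r` no later sign remains, so the partial sums of the coefficients are
exactly the truncated weighted sums. -/
theorem tendsto_sum_coef {l r : ℕ} (hlr : l < r) (e : ℕ) :
    Tendsto (fun M => ∑ i ∈ Finset.range M, coef l r e i) atTop (𝓝 (weightedSum l (e + r) r)) := by
  rw [← tendsto_add_atTop_iff_nat 1]
  obtain ⟨r, rfl⟩ : ∃ r', r = r' + 1 := ⟨r - 1, by omega⟩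
  have h1 : Tendsto (fun M => weightedPartial (barSeq l (r + 1)) (r + 1) e M) atTop
      (𝓝 (weightedSum l (e + (r + 1)) (r + 1))) := by
    unfold weightedPartial weightedSum
    refine tendsto_finsetSum _ fun c hc => ?_
    simp only [Finset.mem_filter, Fintype.mem_piFinset, Finset.mem_Icc] at hc
    have h2 := tendsto_amtvPartial c (fun i => (hc.1 i).1) (barSigns l (r + 1)) (by simp [barSigns])
    rw [← tendsto_add_atTop_iff_nat (r + 1)] at h2
    refine h2.congr fun M => ?_
    rw [add_comm M]
    rfl
  refine h1.congr fun M => ?_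
  rw [weightedPartial_barSeq hlr _ _ _ le_rfl]
  simp

/-! ### Recursions and bounds for the coefficients -/

theorem levelSign_mul_self (l j : ℕ) : levelSign l j * levelSign l j = 1 := by
  unfold levelSign; split_ifs <;> norm_num

theorem abs_levelSign (l j : ℕ) : |levelSign l j| = 1 := by
  unfold levelSign; split_ifs <;> norm_num

/-- The signed partial sums occurring in the recursion of `coef`. -/
noncomputable def coefSum (l j e i : ℕ) : ℝ :=
  2 * levelSign l j ^ (i + 1) * ∑ i' ∈ Finset.range (i + 1), levelSign l j ^ i' * coef l j e i'

theorem coef_zero_succ (l j i : ℕ) :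
    ((j : ℝ) + 1 + 2 * i) * coef l (j + 1) 0 i = coefSum l j 0 i := by
  have h : (j : ℝ) + 1 + 2 * i ≠ 0 := by positivity
  simp only [coef, coefSum, zero_add, Finset.range_one, Finset.sum_singleton, pow_one, Nat.sub_self]
  field_simp

/-- Multiplying by the denominator lowers its exponent by one. The terms with exponent at least 2
give excess `e`; the term with exponent 1 leaves the inner sum. On generating functions this is the
action of `q d/dq`. -/
theorem coef_succ_succ (l j e i : ℕ) :
    ((j : ℝ) + 1 + 2 * i) * coef l (j + 1) (e + 1) i =
      coef l (j + 1) e i + coefSum l j (e + 1) i := by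
  have h : (j : ℝ) + 1 + 2 * i ≠ 0 := by positivity
  simp only [coef, coefSum]
  rw [Finset.sum_range_succ' _ (e + 1)]
  simp only [zero_add, pow_one, Nat.sub_zero, Nat.add_sub_add_right]
  simp_rw [pow_succ (1 / ((j : ℝ) + 1 + 2 * i)) (_ + 1)]
  rw [mul_left_comm, mul_add, mul_add, ← mul_assoc ((j : ℝ) + 1 + 2 * i) (1 / _),
    mul_one_div_cancel h, one_mul]
  congr 1
  rw [Finset.mul_sum]
  congr 1
  refine Finset.sum_congr rfl fun b _ => ?_
  field_simp

theorem coefSum_zero (l j e : ℕ) : coefSum l j e 0 = 2 * levelSign l j * coef l j e 0 := by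
  simp [coefSum]

theorem coefSum_succ (l j e i : ℕ) :
    coefSum l j e (i + 1) =
      levelSign l j * coefSum l j e i + 2 * levelSign l j * coef l j e (i + 1) := by
  unfold coefSum
  rw [Finset.sum_range_succ _ (i + 1)]
  have h : levelSign l j ^ (i + 1) * levelSign l j ^ (i + 1) = 1 := by
    rw [← mul_pow, levelSign_mul_self, one_pow]
  linear_combination (2 * levelSign l j * coef l j e (i + 1)) * h

theorem abs_coefSum_le {l j e : ℕ} {C : ℝ} (h : ∀ i, |coef l j e i| ≤ C) (i : ℕ) :
    |coefSum l j e i| ≤ 2 * C * (i + 1) := by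
  unfold coefSum
  rw [abs_mul, abs_mul, abs_pow, abs_levelSign, one_pow, mul_one, abs_two, mul_assoc]
  gcongr
  refine (Finset.abs_sum_le_sum_abs _ _).trans ?_
  refine (Finset.sum_le_card_nsmul _ _ C fun i' _ => ?_).trans ?_
  · rw [abs_mul, abs_pow, abs_levelSign, one_pow, one_mul]
    exact h i'
  · simp [mul_comm]

/-- A sum of `i + 1` bounded terms grows at most linearly, and the denominator `j + 1 + 2 i` absorbs
this. The induction runs over the depth and, inside it, over the excess. -/
theorem exists_abs_coef_le (l j e : ℕ) : ∃ C, ∀ i, |coef l j e i| ≤ C := by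
  induction j generalizing e with
  | zero =>
    refine ⟨1, fun i => ?_⟩
    simp only [coef]
    split_ifs <;> simp
  | succ j ih =>
    have key : ∀ (i : ℕ) (x y C : ℝ), ((j : ℝ) + 1 + 2 * i) * x = y → |y| ≤ C * (i + 1) → |x| ≤ C := by
      intro i x y C h hy
      have h0 : (0 : ℝ) < (i : ℝ) + 1 := by positivity
      have h1 : (i : ℝ) + 1 ≤ (j : ℝ) + 1 + 2 * i := by
        linarith [(Nat.cast_nonneg i : (0 : ℝ) ≤ i), (Nat.cast_nonneg j : (0 : ℝ) ≤ j)]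
      rw [← h, abs_mul, abs_of_pos (h0.trans_le h1)] at hy
      have := (mul_le_mul_of_nonneg_right h1 (abs_nonneg x)).trans hy
      rw [mul_comm] at this
      exact le_of_mul_le_mul_right this h0
    induction e with
    | zero =>
      obtain ⟨C, hC⟩ := ih 0
      exact ⟨2 * C, fun i => key i _ _ _ (coef_zero_succ l j i) (abs_coefSum_le hC i)⟩
    | succ e ihe =>
      obtain ⟨C, hC⟩ := ih (e + 1)
      obtain ⟨D, hD⟩ := ihe
      refine ⟨D + 2 * C, fun i => key i _ _ _ (coef_succ_succ l j e i) ?_⟩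
      have hD0 : 0 ≤ D := (abs_nonneg _).trans (hD 0)
      have := abs_coefSum_le hC i
      refine (abs_add_le _ _).trans ?_
      have h3 : D ≤ D * (i + 1) := le_mul_of_one_le_right hD0 (by
        linarith [(Nat.cast_nonneg i : (0 : ℝ) ≤ i)])
      have := hD i
      linarith

/-! ### Generating functions in `q` and their differential equations -/

theorem summable_natCast_mul_pow_sub_one {q : ℝ} (h0 : 0 < q) (h1 : q < 1) :
    Summable fun n : ℕ => (n : ℝ) * q ^ (n - 1) := by
  have := (summable_pow_mul_geometric_of_norm_lt_one 1 (r := q)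
    (by rwa [Real.norm_eq_abs, abs_of_pos h0])).div_const q
  refine this.congr fun n => ?_
  rcases n with _ | n
  · simp
  · simp only [Nat.add_sub_cancel, pow_succ]
    field_simp

theorem injective_add_two_mul (j : ℕ) : Function.Injective fun i : ℕ => j + 2 * i := fun a b h => by
  simp only at h
  omega

theorem summable_mul_pow_of_abs_le {c : ℕ → ℝ} {C : ℝ} (hc : ∀ i, |c i| ≤ C * (i + 1)) (j : ℕ) {q : ℝ}
    (h0 : 0 < q) (h1 : q < 1) : Summable fun i => c i * q ^ (j + 2 * i) := by
  have h2 := ((summable_natCast_mul_pow_sub_one h0 h1).comp_injective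
    (injective_add_two_mul (j + 1))).mul_left C
  refine Summable.of_norm_bounded h2 fun i => ?_
  have hC : 0 ≤ C := by simpa using (abs_nonneg _).trans (hc 0)
  rw [norm_mul, Real.norm_eq_abs, Real.norm_eq_abs, abs_of_pos (pow_pos h0 _)]
  simp only [Function.comp_def]
  rw [show j + 1 + 2 * i - 1 = j + 2 * i by omega, ← mul_assoc]
  gcongr
  refine (hc i).trans ?_
  gcongr
  push_cast
  linarith [(Nat.cast_nonneg i : (0 : ℝ) ≤ i), (Nat.cast_nonneg j : (0 : ℝ) ≤ j)]

theorem summable_coef (l j e k : ℕ) {q : ℝ} (h0 : 0 < q) (h1 : q < 1) :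
    Summable fun i => coef l j e i * q ^ (k + 2 * i) := by
  obtain ⟨C, hC⟩ := exists_abs_coef_le l j e
  have hC0 : 0 ≤ C := (abs_nonneg _).trans (hC 0)
  exact summable_mul_pow_of_abs_le (fun i => (hC i).trans (le_mul_of_one_le_right hC0 (by
        linarith [(Nat.cast_nonneg i : (0 : ℝ) ≤ i)]))) k h0 h1

/-- The generating function of the coefficients of given depth and weight. -/
noncomputable def gen (l j e : ℕ) (q : ℝ) : ℝ := ∑' i, coef l j e i * q ^ (j + 2 * i)

theorem gen_zero (l e : ℕ) (q : ℝ) : gen l 0 e q = if e = 0 then 1 else 0 := by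
  unfold gen
  rw [tsum_eq_single 0]
  · simp [coef]
  · intro i hi
    simp [coef, hi]

/-- Signed partial sums obey a first-order recursion, so their generating function is that of the
summands divided by `1 - σ q²`, with `σ` the level sign. -/
theorem tsum_coefSum (l j e : ℕ) {q : ℝ} (h0 : 0 < q) (h1 : q < 1) :
    (1 - levelSign l j * q ^ 2) * ∑' i, coefSum l j e i * q ^ (j + 1 + 2 * i) =
      2 * levelSign l j * q * gen l j e q := by
  obtain ⟨C, hC⟩ := exists_abs_coef_le l j e
  have hs := summable_mul_pow_of_abs_le (abs_coefSum_le hC) (j + 1) h0 h1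
  have hg := summable_coef l j e j h0 h1
  have hg' := (summable_nat_add_iff 1).mpr hg
  have e1 := hs.tsum_eq_zero_add
  have e2 := hg.tsum_eq_zero_add
  have e3 : ∑' i, coefSum l j e (i + 1) * q ^ (j + 1 + 2 * (i + 1)) =
      levelSign l j * q ^ 2 * ∑' i, coefSum l j e i * q ^ (j + 1 + 2 * i) +
      2 * levelSign l j * q * ∑' i, coef l j e (i + 1) * q ^ (j + 2 * (i + 1)) := by
    rw [← tsum_mul_left, ← tsum_mul_left, ← (hs.mul_left _).tsum_add (hg'.mul_left _)]
    refine tsum_congr fun i => ?_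
    rw [coefSum_succ]
    ring
  rw [e3] at e1
  rw [coefSum_zero] at e1
  rw [gen, e2]
  simp only [mul_zero, add_zero] at e1 ⊢
  linear_combination e1

theorem hasDerivAt_tsum_mul_pow {c : ℕ → ℝ} {C : ℝ} (hC : ∀ i, |c i| ≤ C) (j : ℕ) {q : ℝ}
    (h0 : 0 < q) (h1 : q < 1) :
    HasDerivAt (fun q => ∑' i, c i * q ^ (j + 2 * i))
      (∑' i, c i * ((j + 2 * i : ℕ) * q ^ (j + 2 * i - 1))) q := by
  have hC0 : 0 ≤ C := (abs_nonneg _).trans (hC 0)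
  obtain ⟨ρ, hρ0, hρ1⟩ := exists_between h1
  have hρ : 0 < ρ := h0.trans hρ0
  have hu : Summable fun i : ℕ => C * ((j + 2 * i : ℕ) * ρ ^ (j + 2 * i - 1)) :=
    ((summable_natCast_mul_pow_sub_one hρ hρ1).comp_injective (injective_add_two_mul j)).mul_left C
  have hs : Summable fun i => c i * q ^ (j + 2 * i) :=
    summable_mul_pow_of_abs_le (fun i => (hC i).trans (le_mul_of_one_le_right hC0 (by
        linarith [(Nat.cast_nonneg i : (0 : ℝ) ≤ i)]))) j h0 h1
  have hq : q ∈ Set.Ioo 0 ρ := ⟨h0, hρ0⟩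
  refine hasDerivAt_tsum_of_isPreconnected (g := fun i q => c i * q ^ (j + 2 * i))
    (g' := fun i q => c i * ((j + 2 * i : ℕ) * q ^ (j + 2 * i - 1)))
    hu isOpen_Ioo isPreconnected_Ioo ?_ ?_ hq hs hq
  · intro i y _
    exact (hasDerivAt_pow _ y).const_mul _
  · intro i y hy
    rw [norm_mul, norm_mul, norm_pow, Real.norm_eq_abs, Real.norm_of_nonneg hy.1.le,
      Real.norm_of_nonneg (Nat.cast_nonneg _)]
    have h2 : y ^ (j + 2 * i - 1) ≤ ρ ^ (j + 2 * i - 1) := pow_le_pow_left₀ hy.1.le hy.2.le _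
    exact mul_le_mul (hC i) (mul_le_mul_of_nonneg_left h2 (Nat.cast_nonneg _))
      (mul_nonneg (Nat.cast_nonneg _) (pow_nonneg hy.1.le _)) hC0

theorem hasDerivAt_gen (l j e : ℕ) {q : ℝ} (h0 : 0 < q) (h1 : q < 1) :
    HasDerivAt (gen l j e) (∑' i, coef l j e i * ((j + 2 * i : ℕ) * q ^ (j + 2 * i - 1))) q := by
  obtain ⟨C, hC⟩ := exists_abs_coef_le l j e
  exact hasDerivAt_tsum_mul_pow hC j h0 h1

theorem mul_tsum_deriv (l j e : ℕ) {q : ℝ} :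
    q * ∑' i, coef l (j + 1) e i * ((j + 1 + 2 * i : ℕ) * q ^ (j + 1 + 2 * i - 1)) =
      ∑' i, (((j : ℝ) + 1 + 2 * i) * coef l (j + 1) e i) * q ^ (j + 1 + 2 * i) := by
  rw [← tsum_mul_left]
  refine tsum_congr fun i => ?_
  rw [show j + 1 + 2 * i - 1 = j + 2 * i by omega, show j + 1 + 2 * i = j + 2 * i + 1 by omega]
  push_cast
  ring

theorem mul_tsum_deriv_zero (l j : ℕ) {q : ℝ} :
    q * ∑' i, coef l (j + 1) 0 i * ((j + 1 + 2 * i : ℕ) * q ^ (j + 1 + 2 * i - 1)) =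
      ∑' i, coefSum l j 0 i * q ^ (j + 1 + 2 * i) := by
  rw [mul_tsum_deriv]
  simp_rw [coef_zero_succ]

theorem mul_tsum_deriv_succ (l j e : ℕ) {q : ℝ} (h0 : 0 < q) (h1 : q < 1) :
    q * ∑' i, coef l (j + 1) (e + 1) i * ((j + 1 + 2 * i : ℕ) * q ^ (j + 1 + 2 * i - 1)) =
      gen l (j + 1) e q + ∑' i, coefSum l j (e + 1) i * q ^ (j + 1 + 2 * i) := by
  obtain ⟨C, hC⟩ := exists_abs_coef_le l j (e + 1)
  have hs := summable_mul_pow_of_abs_le (abs_coefSum_le hC) (j + 1) h0 h1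
  rw [mul_tsum_deriv, gen, ← (summable_coef l (j + 1) e (j + 1) h0 h1).tsum_add hs]
  simp_rw [coef_succ_succ, add_mul]

/-! ### The substitution `q = tanh (u / 2)` -/

theorem tanh_half_pos {u : ℝ} (hu : 0 < u) : 0 < Real.tanh (u / 2) := by
  rw [Real.tanh_eq_sinh_div_cosh]
  exact div_pos (Real.sinh_pos_iff.mpr (by linarith)) (Real.cosh_pos _)

theorem tanh_half_lt_one (u : ℝ) : Real.tanh (u / 2) < 1 := Real.tanh_lt_one _

theorem hasDerivAt_tanh_half (u : ℝ) :
    HasDerivAt (fun u : ℝ => Real.tanh (u / 2)) ((1 - Real.tanh (u / 2) ^ 2) / 2) u := by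
  have hc := (Real.cosh_pos (u / 2)).ne'
  have h1 : HasDerivAt (fun u : ℝ => u / 2) (1 / 2) u := (hasDerivAt_id u).div_const 2
  have h2 := (h1.sinh).div h1.cosh hc
  have h3 : (fun u : ℝ => Real.tanh (u / 2)) = fun u => Real.sinh (u / 2) / Real.cosh (u / 2) := by
    funext u
    exact Real.tanh_eq_sinh_div_cosh _
  rw [h3]
  refine h2.congr_deriv ?_
  rw [Real.tanh_eq_sinh_div_cosh]
  field_simp

theorem sinh_eq_tanh_half {u : ℝ} (hu : 0 < u) :
    1 / Real.sinh u = (1 - Real.tanh (u / 2) ^ 2) / 2 / Real.tanh (u / 2) := by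
  have hc := (Real.cosh_pos (u / 2)).ne'
  have hs : Real.sinh (u / 2) ≠ 0 := (Real.sinh_pos_iff.mpr (by linarith)).ne'
  have h1 := Real.sinh_two_mul (u / 2)
  rw [mul_div_cancel₀ u two_ne_zero] at h1
  rw [Real.tanh_eq_sinh_div_cosh, h1]
  have h2 := Real.cosh_sq (u / 2)
  field_simp
  linarith

theorem cosh_eq_tanh_half (u : ℝ) :
    1 / Real.cosh u = (1 - Real.tanh (u / 2) ^ 2) / (1 + Real.tanh (u / 2) ^ 2) := by
  have hc := (Real.cosh_pos (u / 2))
  have h1 := Real.cosh_two_mul (u / 2)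
  rw [mul_div_cancel₀ u two_ne_zero] at h1
  rw [Real.tanh_eq_sinh_div_cosh, h1]
  have h2 := Real.cosh_sq (u / 2)
  have h3 : Real.cosh (u / 2) ^ 2 + Real.sinh (u / 2) ^ 2 ≠ 0 := by positivity
  field_simp
  linarith

/-- `log (coth (u / 2))`, an involution of the positive half-line. -/
noncomputable def logCoth (u : ℝ) : ℝ := -Real.log (Real.tanh (u / 2))

theorem hasDerivAt_logCoth {u : ℝ} (hu : 0 < u) :
    HasDerivAt logCoth (-(1 / Real.sinh u)) u := by
  have h := ((hasDerivAt_tanh_half u).log (tanh_half_pos hu).ne').neg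
  rwa [← sinh_eq_tanh_half hu] at h

theorem logCoth_pos {u : ℝ} (hu : 0 < u) : 0 < logCoth u :=
  neg_pos.mpr (Real.log_neg (tanh_half_pos hu) (tanh_half_lt_one u))

theorem exp_neg_logCoth {u : ℝ} (hu : 0 < u) : Real.exp (-logCoth u) = Real.tanh (u / 2) := by
  rw [logCoth, neg_neg, Real.exp_log (tanh_half_pos hu)]

/-- Factor relating the derivative of a level of the chain to the preceding level. -/
noncomputable def rate (l j : ℕ) (u : ℝ) : ℝ := if j < l then 1 else -(1 / Real.cosh u)

/-- The double-angle formulas: `2q/(1 - q²) = sinh u`, and `2q/(1 + q²) = sinh u / cosh u`. -/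
theorem rate_eq (l j : ℕ) {u : ℝ} (hu : 0 < u) :
    1 / Real.sinh u * (2 * levelSign l j * Real.tanh (u / 2)) =
      rate l j u * (1 - levelSign l j * Real.tanh (u / 2) ^ 2) := by
  have h0 := tanh_half_pos hu
  rw [sinh_eq_tanh_half hu]
  unfold levelSign rate
  rw [cosh_eq_tanh_half u]
  split_ifs
  · field_simp
  · have : 1 + Real.tanh (u / 2) ^ 2 ≠ 0 := by positivity
    field_simp
    ring

theorem one_sub_levelSign_ne_zero (l j : ℕ) {q : ℝ} (h0 : 0 < q) (h1 : q < 1) :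
    1 - levelSign l j * q ^ 2 ≠ 0 := by
  unfold levelSign
  split_ifs
  · nlinarith
  · nlinarith

theorem hasDerivAt_gen_tanh_aux (l j e : ℕ) {u : ℝ} (hu : 0 < u) {x : ℝ}
    (h : Real.tanh (u / 2) * ∑' i, coef l (j + 1) e i * ((j + 1 + 2 * i : ℕ) *
      Real.tanh (u / 2) ^ (j + 1 + 2 * i - 1)) =
      x + ∑' i, coefSum l j e i * Real.tanh (u / 2) ^ (j + 1 + 2 * i)) :
    HasDerivAt (fun u => gen l (j + 1) e (Real.tanh (u / 2)))
      (1 / Real.sinh u * x + rate l j u * gen l j e (Real.tanh (u / 2))) u := by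
  have h0 := tanh_half_pos hu
  have h1 := tanh_half_lt_one u
  have hd := (hasDerivAt_gen l (j + 1) e h0 h1).comp u (hasDerivAt_tanh_half u)
  refine hd.congr_deriv ?_
  have h2 := tsum_coefSum l j e h0 h1
  have h3 := rate_eq l j hu
  have h4 := sinh_eq_tanh_half hu
  have h5 := one_sub_levelSign_ne_zero l j h0 h1
  rw [eq_div_iff h0.ne'] at h4
  rw [← h4]
  have h6 : 1 / Real.sinh u * ∑' i, coefSum l j e i * Real.tanh (u / 2) ^ (j + 1 + 2 * i) =
      rate l j u * gen l j e (Real.tanh (u / 2)) := by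
    apply mul_left_cancel₀ h5
    linear_combination 1 / Real.sinh u * h2 + gen l j e (Real.tanh (u / 2)) * h3
  linear_combination 1 / Real.sinh u * h + h6

/-! ### The chain of iterated integrals -/

/-- The iterated integrals of the chain, in the variable `u` with `q = tanh (u / 2)`. -/
noncomputable def chainFun (l j e : ℕ) (u : ℝ) : ℝ :=
  ∑ b ∈ Finset.range (e + 1),
    gen l j (e - b) (Real.tanh (u / 2)) * (logCoth u ^ b / (b.factorial : ℝ))

theorem chainFun_zero (l e : ℕ) (u : ℝ) : chainFun l 0 e u = logCoth u ^ e / (e.factorial : ℝ) := by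
  unfold chainFun
  rw [Finset.sum_eq_single e]
  · simp [gen_zero]
  · intro b hb hbe
    rw [Finset.mem_range] at hb
    rw [gen_zero, if_neg (by omega), zero_mul]
  · simp

theorem hasDerivAt_logCoth_pow {u : ℝ} (hu : 0 < u) (b : ℕ) :
    HasDerivAt (fun u => logCoth u ^ (b + 1) / ((b + 1).factorial : ℝ))
      (-(1 / Real.sinh u) * (logCoth u ^ b / (b.factorial : ℝ))) u := by
  have h := ((hasDerivAt_logCoth hu).pow (b + 1)).div_const ((b + 1).factorial : ℝ)
  refine h.congr_deriv ?_
  rw [Nat.factorial_succ]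
  push_cast
  have : (b.factorial : ℝ) ≠ 0 := by positivity
  field_simp

/-- The form `du/sinh u` enters twice with opposite signs: through the lowering of the excess in the
generating functions and through the derivative of the powers of `logCoth`. These contributions
telescope away, and only the form of the level survives. -/
theorem hasDerivAt_chainFun (l j e : ℕ) {u : ℝ} (hu : 0 < u) :
    HasDerivAt (chainFun l (j + 1) e) (rate l j u * chainFun l j e u) u := by
  have h0 := tanh_half_pos hu
  have h1 := tanh_half_lt_one u
  have hg0 : HasDerivAt (fun u => gen l (j + 1) 0 (Real.tanh (u / 2)))
      (rate l j u * gen l j 0 (Real.tanh (u / 2))) u := by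
    have := hasDerivAt_gen_tanh_aux l j 0 hu (x := 0) (by rw [mul_tsum_deriv_zero, zero_add])
    simpa using this
  have hg : ∀ e, HasDerivAt (fun u => gen l (j + 1) (e + 1) (Real.tanh (u / 2)))
      (1 / Real.sinh u * gen l (j + 1) e (Real.tanh (u / 2)) +
        rate l j u * gen l j (e + 1) (Real.tanh (u / 2))) u := fun e =>
    hasDerivAt_gen_tanh_aux l j (e + 1) hu (mul_tsum_deriv_succ l j e h0 h1)
  rcases e with _ | e
  · unfold chainFun
    simpa using hg0
  · have e1 : chainFun l (j + 1) (e + 1) = fun u =>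
        (∑ b ∈ Finset.range e, gen l (j + 1) (e - b) (Real.tanh (u / 2)) *
          (logCoth u ^ (b + 1) / ((b + 1).factorial : ℝ)) +
          gen l (j + 1) 0 (Real.tanh (u / 2)) * (logCoth u ^ (e + 1) / ((e + 1).factorial : ℝ))) +
        gen l (j + 1) (e + 1) (Real.tanh (u / 2)) := by
      funext u
      unfold chainFun
      rw [Finset.sum_range_succ', Finset.sum_range_succ]
      simp
    rw [e1]
    have hsum : HasDerivAt (fun u => ∑ b ∈ Finset.range e, gen l (j + 1) (e - b) (Real.tanh (u / 2)) *
          (logCoth u ^ (b + 1) / ((b + 1).factorial : ℝ)))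
        (∑ b ∈ Finset.range e, ((1 / Real.sinh u * gen l (j + 1) (e - (b + 1)) (Real.tanh (u / 2)) +
          rate l j u * gen l j (e - b) (Real.tanh (u / 2))) *
          (logCoth u ^ (b + 1) / ((b + 1).factorial : ℝ)) +
          gen l (j + 1) (e - b) (Real.tanh (u / 2)) *
          (-(1 / Real.sinh u) * (logCoth u ^ b / (b.factorial : ℝ))))) u := by
      refine HasDerivAt.fun_sum fun b hb => ?_
      rw [Finset.mem_range] at hb
      have := hg (e - (b + 1))
      rw [show e - (b + 1) + 1 = e - b by omega] at this
      exact this.mul (hasDerivAt_logCoth_pow hu b)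
    refine ((hsum.add (hg0.mul (hasDerivAt_logCoth_pow hu e))).add (hg e)).congr_deriv ?_
    unfold chainFun
    rw [Finset.sum_range_succ', Finset.sum_range_succ _ e]
    simp only [Nat.add_sub_add_right, Nat.sub_self, pow_zero, Nat.factorial_zero, Nat.cast_one,
      div_one, mul_one, Nat.sub_zero]
    have tel : ∑ b ∈ Finset.range e, (gen l (j + 1) (e - (b + 1)) (Real.tanh (u / 2)) *
        (logCoth u ^ (b + 1) / ((b + 1).factorial : ℝ)) -
        gen l (j + 1) (e - b) (Real.tanh (u / 2)) * (logCoth u ^ b / (b.factorial : ℝ))) =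
        gen l (j + 1) 0 (Real.tanh (u / 2)) * (logCoth u ^ e / (e.factorial : ℝ)) -
        gen l (j + 1) e (Real.tanh (u / 2)) := by
      rw [Finset.sum_range_sub (fun b => gen l (j + 1) (e - b) (Real.tanh (u / 2)) *
        (logCoth u ^ b / (b.factorial : ℝ)))]
      simp
    have split : ∑ b ∈ Finset.range e, ((1 / Real.sinh u * gen l (j + 1) (e - (b + 1)) (Real.tanh (u / 2)) +
          rate l j u * gen l j (e - b) (Real.tanh (u / 2))) *
          (logCoth u ^ (b + 1) / ((b + 1).factorial : ℝ)) +
          gen l (j + 1) (e - b) (Real.tanh (u / 2)) *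
          (-(1 / Real.sinh u) * (logCoth u ^ b / (b.factorial : ℝ)))) =
        1 / Real.sinh u * (gen l (j + 1) 0 (Real.tanh (u / 2)) * (logCoth u ^ e / (e.factorial : ℝ)) -
        gen l (j + 1) e (Real.tanh (u / 2))) + rate l j u *
          ∑ b ∈ Finset.range e, gen l j (e - b) (Real.tanh (u / 2)) *
            (logCoth u ^ (b + 1) / ((b + 1).factorial : ℝ)) := by
      rw [← tel, Finset.mul_sum, Finset.mul_sum, ← Finset.sum_add_distrib]
      refine Finset.sum_congr rfl fun b _ => ?_
      ring
    rw [split]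
    ring

/-! ### Asymptotics and integrability of `logCoth` -/

theorem exp_neg_le_one_sub_tanh_sq {u : ℝ} (hu : 0 ≤ u) :
    Real.exp (-u) ≤ 1 - Real.tanh (u / 2) ^ 2 := by
  have hc := Real.cosh_pos (u / 2)
  have h1 : 1 - Real.tanh (u / 2) ^ 2 = 1 / Real.cosh (u / 2) ^ 2 := by
    rw [Real.tanh_eq_sinh_div_cosh]
    have := Real.cosh_sq (u / 2)
    field_simp
    linarith
  rw [h1, le_div_iff₀ (by positivity)]
  have h2 : Real.cosh (u / 2) ≤ Real.exp (u / 2) := by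
    rw [Real.cosh_eq]
    have : Real.exp (-(u / 2)) ≤ Real.exp (u / 2) := Real.exp_le_exp.mpr (by linarith)
    linarith
  calc Real.exp (-u) * Real.cosh (u / 2) ^ 2 ≤ Real.exp (-u) * Real.exp (u / 2) ^ 2 := by gcongr
    _ = 1 := by rw [← Real.exp_nat_mul, ← Real.exp_add]; norm_num; ring

theorem tanh_half_mul (u : ℝ) : Real.tanh (u / 2) * (1 + Real.exp (-u)) = 1 - Real.exp (-u) := by
  have hc := Real.cosh_pos (u / 2)
  rw [Real.tanh_eq_sinh_div_cosh, div_mul_eq_mul_div, div_eq_iff hc.ne', Real.sinh_eq, Real.cosh_eq]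
  have h1 : Real.exp (-u) = Real.exp (-(u / 2)) * Real.exp (-(u / 2)) := by
    rw [← Real.exp_add]; ring_nf
  have h2 : Real.exp (u / 2) * Real.exp (-(u / 2)) = 1 := by
    rw [← Real.exp_add]; simp
  rw [h1]
  linear_combination Real.exp (-(u / 2)) * h2

theorem tendsto_tanh_half_atTop : Tendsto (fun u : ℝ => Real.tanh (u / 2)) atTop (𝓝 1) := by
  have h1 : Tendsto (fun u : ℝ => Real.exp (-u)) atTop (𝓝 0) :=
    Real.tendsto_exp_atBot.comp tendsto_neg_atTop_atBot
  have h2 : Tendsto (fun u : ℝ => (1 - Real.exp (-u)) / (1 + Real.exp (-u))) atTop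
      (𝓝 ((1 - 0) / (1 + 0))) := (h1.const_sub 1).div (h1.const_add 1) (by norm_num)
  rw [sub_zero, add_zero, div_one] at h2
  refine h2.congr fun u => ?_
  rw [← tanh_half_mul, mul_div_cancel_right₀]
  positivity

theorem tendsto_logCoth_atTop : Tendsto logCoth atTop (𝓝 0) := by
  have := ((Real.continuousAt_log one_ne_zero).tendsto.comp tendsto_tanh_half_atTop).neg
  rw [Real.log_one, neg_zero] at this
  exact this

theorem tendsto_tanh_half_zero : Tendsto (fun u : ℝ => Real.tanh (u / 2)) (𝓝[>] 0) (𝓝[>] 0) := by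
  refine tendsto_nhdsWithin_iff.mpr ⟨?_, ?_⟩
  · have h : Tendsto (fun u : ℝ => Real.tanh (u / 2)) (𝓝 0) (𝓝 (Real.tanh (0 / 2))) :=
      (hasDerivAt_tanh_half 0).continuousAt
    rw [zero_div, Real.tanh_zero] at h
    exact h.mono_left nhdsWithin_le_nhds
  · filter_upwards [self_mem_nhdsWithin] with u hu
    exact tanh_half_pos hu

theorem tendsto_logCoth_zero : Tendsto logCoth (𝓝[>] 0) atTop :=
  tendsto_neg_atBot_atTop.comp (Real.tendsto_log_nhdsGT_zero.comp tendsto_tanh_half_zero)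

theorem continuousOn_logCoth : ContinuousOn logCoth (Set.Ioi 0) := fun _ hu =>
  (hasDerivAt_logCoth hu).continuousAt.continuousWithinAt

/-- From `log x ≤ x - 1` at `x = coth (u/2)`. It expresses the decay `logCoth u = O(exp (-u))`
without dividing by `1 - exp (-u)`, hence down to `u = 0`. -/
theorem logCoth_mul_le {u : ℝ} (hu : 0 < u) :
    logCoth u * (1 - Real.exp (-u)) ≤ 2 * Real.exp (-u) := by
  have h0 := tanh_half_pos hu
  have h1 := Real.log_le_sub_one_of_pos (inv_pos.mpr h0)
  rw [Real.log_inv] at h1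
  have h2 := tanh_half_mul u
  have h3 : (Real.tanh (u / 2))⁻¹ * Real.tanh (u / 2) = 1 := inv_mul_cancel₀ h0.ne'
  have h4 : 0 ≤ 1 - Real.exp (-u) := by
    rw [← h2]; positivity
  have h5 : (Real.tanh (u / 2))⁻¹ * (1 - Real.exp (-u)) = 1 + Real.exp (-u) := by
    rw [← h2, ← mul_assoc, h3, one_mul]
  unfold logCoth
  nlinarith

theorem integrableOn_deriv_sqrt_tanh :
    MeasureTheory.IntegrableOn
      (fun u : ℝ => (1 - Real.tanh (u / 2) ^ 2) / 2 / (2 * √(Real.tanh (u / 2)))) (Set.Ioi 0) := by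
  refine MeasureTheory.integrableOn_Ioi_deriv_of_nonneg (g := fun u => √(Real.tanh (u / 2)))
    (l := √1) ?_ ?_ ?_ ?_
  · exact ((Real.continuous_sqrt.continuousAt.comp
      (hasDerivAt_tanh_half 0).continuousAt)).continuousWithinAt
  · intro u hu
    exact (hasDerivAt_tanh_half u).sqrt (tanh_half_pos hu).ne'
  · intro u hu
    have h0 := tanh_half_pos hu
    have h1 := tanh_half_lt_one u
    have : 0 ≤ 1 - Real.tanh (u / 2) ^ 2 := by nlinarith
    positivity
  · exact (Real.continuous_sqrt.tendsto 1).comp tendsto_tanh_half_atTop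

/-- With `t = tanh (u/2)`, the logarithmic singularity satisfies `logCoth^k ≤ k! 2^k exp (logCoth/2)
= k! 2^k / √t`, and `exp (-u) ≤ 1 - t²`. The resulting majorant is a multiple of the derivative of
`√t`; the factor 4 undoes the halves in that derivative. -/
theorem integrableOn_logCoth_pow_mul_exp (k : ℕ) :
    MeasureTheory.IntegrableOn (fun u : ℝ => logCoth u ^ k * Real.exp (-u)) (Set.Ioi 0) := by
  refine MeasureTheory.Integrable.mono'
    (integrableOn_deriv_sqrt_tanh.const_mul (k.factorial * 2 ^ k * 4)) ?_ ?_
  · refine ContinuousOn.aestronglyMeasurable ?_ measurableSet_Ioi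
    exact (continuousOn_logCoth.pow k).mul (by fun_prop)
  · refine (MeasureTheory.ae_restrict_iff' measurableSet_Ioi).mpr (Eventually.of_forall fun u hu => ?_)
    have h0 := tanh_half_pos hu
    have hs := logCoth_pos hu
    rw [Real.norm_of_nonneg (by positivity)]
    have h1 := Real.pow_div_factorial_le_exp (logCoth u / 2) (by positivity) k
    have h2 : Real.exp (logCoth u / 2) = 1 / √(Real.tanh (u / 2)) := by
      rw [← exp_neg_logCoth hu, ← Real.exp_half, one_div, ← Real.exp_neg]
      congr 1
      ring
    rw [h2, div_le_iff₀ (by positivity), div_pow, div_le_iff₀ (by positivity)] at h1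
    have h3 := exp_neg_le_one_sub_tanh_sq (le_of_lt hu)
    calc _ ≤ 1 / √(Real.tanh (u / 2)) * (k.factorial : ℝ) * 2 ^ k * (1 - Real.tanh (u / 2) ^ 2) := by
          gcongr
      _ = _ := by ring

/-- Two of the powers of `logCoth` decay like `exp (-2u)` at infinity and beat the growth `exp
(u/2)`. -/
theorem integrableOn_logCoth_pow_mul_exp_half (k : ℕ) :
    MeasureTheory.IntegrableOn (fun u : ℝ => logCoth u ^ (k + 2) * Real.exp (u / 2)) (Set.Ioi 0) := by
  refine MeasureTheory.Integrable.mono'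
    (((integrableOn_logCoth_pow_mul_exp k).const_mul 8).add
      ((integrableOn_logCoth_pow_mul_exp (k + 2)).const_mul 2)) ?_ ?_
  · refine ContinuousOn.aestronglyMeasurable ?_ measurableSet_Ioi
    exact (continuousOn_logCoth.pow _).mul (by fun_prop)
  · refine (MeasureTheory.ae_restrict_iff' measurableSet_Ioi).mpr (Eventually.of_forall fun u hu => ?_)
    have hu' : 0 < u := hu
    have hs := logCoth_pos hu
    rw [Real.norm_of_nonneg (by positivity)]
    have h1 := logCoth_mul_le hu
    set q := Real.exp (-u) with hq
    have hq0 : 0 < q := Real.exp_pos _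
    have hq1 : q < 1 := Real.exp_lt_one_iff.mpr (by linarith)
    have h2 : (logCoth u * (1 - q)) ^ 2 ≤ (2 * q) ^ 2 :=
      pow_le_pow_left₀ (mul_nonneg hs.le (by linarith)) h1 2
    have h3 : q ^ 2 * Real.exp (u / 2) ≤ q := by
      rw [hq, ← Real.exp_nat_mul, ← Real.exp_add]
      refine Real.exp_le_exp.mpr ?_
      push_cast
      linarith
    -- The right side is `1 + (1 - 2q)²`. It splits the integrand into a part controlled by the
    -- decay of `logCoth` at infinity and a part where `q²` already absorbs the exponential.
    have h4 : (1 : ℝ) ≤ 2 * (1 - q) ^ 2 + 2 * q ^ 2 := by nlinarith [sq_nonneg (1 - 2 * q)]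
    have hk : 0 < logCoth u ^ k := pow_pos hs k
    simp only [Pi.add_apply]
    calc logCoth u ^ (k + 2) * Real.exp (u / 2)
        ≤ logCoth u ^ (k + 2) * Real.exp (u / 2) * (2 * (1 - q) ^ 2 + 2 * q ^ 2) :=
          le_mul_of_one_le_right (by positivity) h4
      _ = 2 * logCoth u ^ k * (logCoth u * (1 - q)) ^ 2 * Real.exp (u / 2) +
          2 * logCoth u ^ (k + 2) * (q ^ 2 * Real.exp (u / 2)) := by ring
      _ ≤ 2 * logCoth u ^ k * (2 * q) ^ 2 * Real.exp (u / 2) +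
          2 * logCoth u ^ (k + 2) * q := by gcongr
      _ = 8 * logCoth u ^ k * (q ^ 2 * Real.exp (u / 2)) + 2 * logCoth u ^ (k + 2) * q := by ring
      _ ≤ 8 * logCoth u ^ k * q + 2 * logCoth u ^ (k + 2) * q := by gcongr
      _ = _ := by ring

/-! ### Behaviour of the chain at `0` and at infinity -/

theorem abs_gen_succ_le (l j e : ℕ) :
    ∃ K, ∀ q : ℝ, 0 < q → q ≤ 1 / 2 → |gen l (j + 1) e q| ≤ K * q := by
  obtain ⟨C, hC⟩ := exists_abs_coef_le l (j + 1) e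
  have hC0 : 0 ≤ C := (abs_nonneg _).trans (hC 0)
  have hg : Summable fun i : ℕ => (1 / 2 : ℝ) ^ i := summable_geometric_two
  refine ⟨C * ∑' i : ℕ, (1 / 2 : ℝ) ^ i, fun q h0 h1 => ?_⟩
  rw [mul_right_comm, ← tsum_mul_left]
  unfold gen
  rw [← Real.norm_eq_abs]
  refine tsum_of_norm_bounded (hg.mul_left (C * q)).hasSum fun i => ?_
  rw [norm_mul, norm_pow, Real.norm_eq_abs, Real.norm_of_nonneg h0.le, mul_assoc]
  refine mul_le_mul (hC i) ?_ (by positivity) hC0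
  rw [show j + 1 + 2 * i = (j + i) + i + 1 by ring, pow_succ, mul_comm, pow_add]
  have h2 : q ^ (j + i) ≤ 1 := pow_le_one₀ h0.le (by linarith)
  have h3 : q ^ i ≤ (1 / 2) ^ i := pow_le_pow_left₀ h0.le h1 i
  gcongr
  calc q ^ (j + i) * q ^ i ≤ 1 * (1 / 2) ^ i := by gcongr
    _ = _ := one_mul _

/-- In positive depth the generating function is `O(q)` with `q = exp (-logCoth u)`, which beats
every power of `logCoth u`. -/
theorem tendsto_chainFun_zero (l j e : ℕ) : Tendsto (chainFun l (j + 1) e) (𝓝[>] 0) (𝓝 0) := by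
  suffices h : ∀ b, Tendsto (fun u => gen l (j + 1) (e - b) (Real.tanh (u / 2)) *
      (logCoth u ^ b / (b.factorial : ℝ))) (𝓝[>] 0) (𝓝 0) by
    have := tendsto_finsetSum (Finset.range (e + 1)) fun b _ => h b
    rwa [Finset.sum_const_zero] at this
  intro b
  obtain ⟨K, hK⟩ := abs_gen_succ_le l j (e - b)
  have h1 : Tendsto (fun u => K / (b.factorial : ℝ) * (logCoth u ^ b * Real.exp (-logCoth u)))
      (𝓝[>] 0) (𝓝 (K / (b.factorial : ℝ) * 0)) :=
    ((Real.tendsto_pow_mul_exp_neg_atTop_nhds_zero b).comp tendsto_logCoth_zero).const_mul _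
  rw [mul_zero] at h1
  refine squeeze_zero_norm' ?_ h1
  have h2 : ∀ᶠ u : ℝ in 𝓝[>] 0, Real.tanh (u / 2) ≤ 1 / 2 :=
    (tendsto_tanh_half_zero.mono_right nhdsWithin_le_nhds).eventually_le_const (by norm_num)
  filter_upwards [h2, self_mem_nhdsWithin] with u hu2 hu
  have hs := logCoth_pos hu
  rw [norm_mul, Real.norm_eq_abs, Real.norm_of_nonneg (by positivity), exp_neg_logCoth hu]
  calc _ ≤ K * Real.tanh (u / 2) * (logCoth u ^ b / (b.factorial : ℝ)) := by
        gcongr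
        exact hK _ (tanh_half_pos hu) hu2
    _ = _ := by ring

/-- Abel's limit theorem in the variable `q²`: the coefficient series need only converge
conditionally. -/
theorem tendsto_gen_atTop {l r : ℕ} (hlr : l < r) (e : ℕ) :
    Tendsto (fun u : ℝ => gen l r e (Real.tanh (u / 2))) atTop (𝓝 (weightedSum l (e + r) r)) := by
  have h1 := Real.tendsto_tsum_powerSeries_nhdsWithin_lt (tendsto_sum_coef hlr e)
  have h2 : Tendsto (fun u : ℝ => Real.tanh (u / 2) ^ 2) atTop (𝓝[<] 1) := by
    refine tendsto_nhdsWithin_iff.mpr ⟨by simpa using tendsto_tanh_half_atTop.pow 2, ?_⟩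
    filter_upwards [eventually_gt_atTop 0] with u hu
    exact pow_lt_one₀ (tanh_half_pos hu).le (tanh_half_lt_one u) two_ne_zero
  have h3 := (tendsto_tanh_half_atTop.pow r).mul (h1.comp h2)
  rw [one_pow, one_mul] at h3
  refine h3.congr fun u => ?_
  simp only [Function.comp_def, gen]
  rw [← tsum_mul_left]
  refine tsum_congr fun i => ?_
  rw [pow_add, pow_mul]
  ring

theorem tendsto_chainFun_atTop {l r : ℕ} (hlr : l < r) (e : ℕ) :
    Tendsto (chainFun l r e) atTop (𝓝 (weightedSum l (e + r) r)) := by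
  have h1 : ∀ b, Tendsto (fun u => gen l r (e - b) (Real.tanh (u / 2)) *
      (logCoth u ^ b / (b.factorial : ℝ))) atTop
      (𝓝 (weightedSum l (e - b + r) r * (0 ^ b / (b.factorial : ℝ)))) := fun b =>
    (tendsto_gen_atTop hlr (e - b)).mul ((tendsto_logCoth_atTop.pow b).div_const _)
  have h2 := tendsto_finsetSum (Finset.range (e + 1)) fun b _ => h1 b
  rw [Finset.sum_range_succ'] at h2
  simp only [ne_eq, Nat.add_eq_zero_iff, one_ne_zero, and_false, not_false_eq_true, zero_pow,
    zero_div, mul_zero, Finset.sum_const_zero, zero_add, pow_zero, Nat.factorial_zero, Nat.cast_one,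
    div_one, mul_one, Nat.sub_zero] at h2
  exact h2

theorem abs_rate_le (l j : ℕ) (u : ℝ) : |rate l j u| ≤ 1 := by
  unfold rate
  split_ifs
  · simp
  · rw [abs_neg, abs_of_pos (by positivity [Real.cosh_pos u]), div_le_one (Real.cosh_pos u)]
    exact Real.one_le_cosh u

/-- The rates are at most 1 in absolute value, so each integration raises the degree of growth by at
most one. -/
theorem abs_chainFun_le (l j e : ℕ) : ∃ C, 0 ≤ C ∧ ∀ u, 1 ≤ u → |chainFun l j e u| ≤ C * u ^ j := by
  induction j with
  | zero =>
    refine ⟨logCoth 1 ^ e / (e.factorial : ℝ), by positivity [logCoth_pos one_pos], fun u hu => ?_⟩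
    have hu0 : 0 < u := by linarith
    have hs := logCoth_pos hu0
    rw [chainFun_zero, pow_zero, mul_one, abs_of_nonneg (by positivity)]
    have hle : logCoth u ≤ logCoth 1 := by
      unfold logCoth
      refine neg_le_neg (Real.log_le_log (tanh_half_pos one_pos) ?_)
      exact monotone_of_hasDerivAt_nonneg (fun v => hasDerivAt_tanh_half v) (fun v => by
        have h1 := Real.tanh_lt_one (v / 2)
        have h2 := Real.neg_one_lt_tanh (v / 2)
        have : 0 ≤ 1 - Real.tanh (v / 2) ^ 2 := by nlinarith
        simp only [Pi.zero_apply]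
        positivity) hu
    gcongr
  | succ j ih =>
    obtain ⟨C, hC0, hC⟩ := ih
    refine ⟨|chainFun l (j + 1) e 1| + C, by positivity, fun u hu => ?_⟩
    have hu0 : 0 < u := by linarith
    have h1 : ‖chainFun l (j + 1) e u - chainFun l (j + 1) e 1‖ ≤ C * u ^ j * ‖u - 1‖ := by
      refine Convex.norm_image_sub_le_of_norm_hasDerivWithin_le (s := Set.Icc 1 u)
        (f' := fun v => rate l j v * chainFun l j e v) (fun v hv => ?_) (fun v hv => ?_)
        (convex_Icc 1 u) ⟨le_rfl, hu⟩ ⟨hu, le_rfl⟩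
      · exact (hasDerivAt_chainFun l j e (by linarith [hv.1])).hasDerivWithinAt
      · rw [norm_mul]
        have hv0 : 0 ≤ v := by linarith [hv.1]
        calc _ ≤ 1 * (C * v ^ j) :=
              mul_le_mul (abs_rate_le l j v) (hC v hv.1) (abs_nonneg _) zero_le_one
          _ ≤ C * u ^ j := by
            rw [one_mul]
            have := hv.2
            gcongr
    rw [Real.norm_eq_abs, Real.norm_of_nonneg (by linarith)] at h1
    have h2 := abs_sub_abs_le_abs_sub (chainFun l (j + 1) e u) (chainFun l (j + 1) e 1)
    have h3 : C * u ^ j * (u - 1) ≤ C * u ^ (j + 1) := by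
      rw [pow_succ, ← mul_assoc]
      gcongr
      linarith
    have h4 : |chainFun l (j + 1) e 1| ≤ |chainFun l (j + 1) e 1| * u ^ (j + 1) :=
      le_mul_of_one_le_right (abs_nonneg _) (one_le_pow₀ hu)
    rw [add_mul]
    linarith

/-! ### Holomorphic functions with exponential decay on the strip -/

/-- Holomorphic functions on the strip `0 < Im u < π` which, on every closed substrip and for every
exponent `0 < c ≤ 1`, are bounded by a multiple of `exp (-c Re u)`. -/
structure StripDecay (F : ℂ → ℂ) : Prop where
  differentiableAt : ∀ u : ℂ, 0 < u.im → u.im < Real.pi → DifferentiableAt ℂ F u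
  bound : ∀ η > 0, ∀ c : ℝ, 0 < c → c ≤ 1 → ∃ C, ∀ u : ℂ, η ≤ u.im → u.im ≤ Real.pi - η →
    ‖F u‖ ≤ C * Real.exp (-(c * u.re))

theorem isOpen_strip : IsOpen {u : ℂ | 0 < u.im ∧ u.im < Real.pi} :=
  (isOpen_lt continuous_const Complex.continuous_im).inter
    (isOpen_lt Complex.continuous_im continuous_const)

/-- The integral of a function along a horizontal ray to the right. -/
noncomputable def tail (F : ℂ → ℂ) (u : ℂ) : ℂ := ∫ t in Set.Ioi (0 : ℝ), F (u + t)

namespace StripDecay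

variable {F G : ℂ → ℂ}

/-- Since every rate in `(0, 1]` is available, each factor may be used at half the required rate. -/
theorem mul (hF : StripDecay F) (hG : StripDecay G) : StripDecay fun u => F u * G u where
  differentiableAt u h0 h1 := (hF.differentiableAt u h0 h1).mul (hG.differentiableAt u h0 h1)
  bound η hη c hc hc1 := by
    obtain ⟨C, hC⟩ := hF.bound η hη (c / 2) (by linarith) (by linarith)
    obtain ⟨D, hD⟩ := hG.bound η hη (c / 2) (by linarith) (by linarith)
    refine ⟨C * D, fun u h0 h1 => ?_⟩
    rw [norm_mul]
    calc _ ≤ (C * Real.exp (-(c / 2 * u.re))) * (D * Real.exp (-(c / 2 * u.re))) :=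
          mul_le_mul (hC u h0 h1) (hD u h0 h1) (norm_nonneg _) ((norm_nonneg _).trans (hC u h0 h1))
      _ = C * D * (Real.exp (-(c / 2 * u.re)) * Real.exp (-(c / 2 * u.re))) := by ring
      _ = _ := by
        rw [← Real.exp_add]
        congr 2
        ring

theorem const_mul (hF : StripDecay F) (a : ℂ) : StripDecay fun u => a * F u where
  differentiableAt u h0 h1 := (hF.differentiableAt u h0 h1).const_mul a
  bound η hη c hc hc1 := by
    obtain ⟨C, hC⟩ := hF.bound η hη c hc hc1
    refine ⟨‖a‖ * C, fun u h0 h1 => ?_⟩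
    rw [norm_mul, mul_assoc]
    exact mul_le_mul_of_nonneg_left (hC u h0 h1) (norm_nonneg _)

theorem pow_succ (hF : StripDecay F) (n : ℕ) : StripDecay fun u => F u ^ (n + 1) := by
  induction n with
  | zero => simpa using hF
  | succ n ih =>
    have := ih.mul hF
    simpa only [← _root_.pow_succ] using this

/-- Cauchy's estimate on discs of radius `η/2`, which stay in a slightly larger closed substrip; on
such a disc the exponential changes by at most `exp (c η/2)`. -/
protected theorem deriv (hF : StripDecay F) : StripDecay (deriv F) where
  differentiableAt u h0 h1 := by
    have hd : DifferentiableOn ℂ F {u : ℂ | 0 < u.im ∧ u.im < Real.pi} := fun w hw =>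
      (hF.differentiableAt w hw.1 hw.2).differentiableWithinAt
    exact (hd.deriv isOpen_strip).differentiableAt (isOpen_strip.mem_nhds ⟨h0, h1⟩)
  bound η hη c hc hc1 := by
    obtain ⟨C, hC⟩ := hF.bound (η / 2) (by linarith) c hc hc1
    refine ⟨C * Real.exp (c * (η / 2)) / (η / 2), fun u h0 h1 => ?_⟩
    have him : ∀ z ∈ Metric.closedBall u (η / 2), |z.im - u.im| ≤ η / 2 ∧ |z.re - u.re| ≤ η / 2 := by
      intro z hz
      rw [Metric.mem_closedBall, Complex.dist_eq] at hz
      exact ⟨(Complex.abs_im_le_norm (z - u)).trans hz, (Complex.abs_re_le_norm (z - u)).trans hz⟩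
    have hd : DiffContOnCl ℂ F (Metric.ball u (η / 2)) := by
      refine DifferentiableOn.diffContOnCl fun z hz => ?_
      have := abs_le.mp (him z (Metric.closure_ball_subset_closedBall hz)).1
      exact (hF.differentiableAt z (by linarith) (by linarith)).differentiableWithinAt
    have hC0 : 0 ≤ C := by
      have := (norm_nonneg _).trans (hC u (by linarith) (by linarith))
      exact nonneg_of_mul_nonneg_left this (Real.exp_pos _)
    have := Complex.norm_deriv_le_of_forall_mem_sphere_norm_le (by linarith : 0 < η / 2) hd
      (C := C * Real.exp (c * (η / 2)) * Real.exp (-(c * u.re))) (fun z hz => by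
        have h2 := abs_le.mp (him z (Metric.sphere_subset_closedBall hz)).1
        have h3 := abs_le.mp (him z (Metric.sphere_subset_closedBall hz)).2
        refine (hC z (by linarith) (by linarith)).trans ?_
        rw [mul_assoc, ← Real.exp_add]
        gcongr
        nlinarith)
    refine this.trans (le_of_eq ?_)
    ring

theorem exists_margin {u : ℂ} (h0 : 0 < u.im) (h1 : u.im < Real.pi) :
    ∃ η > 0, 2 * η ≤ u.im ∧ u.im ≤ Real.pi - 2 * η :=
  ⟨min (u.im / 2) ((Real.pi - u.im) / 2), lt_min (by linarith) (by linarith),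
    by linarith [min_le_left (u.im / 2) ((Real.pi - u.im) / 2)],
    by linarith [min_le_right (u.im / 2) ((Real.pi - u.im) / 2)]⟩

theorem continuous_ray (hF : StripDecay F) {u : ℂ} (h0 : 0 < u.im) (h1 : u.im < Real.pi) :
    Continuous fun t : ℝ => F (u + t) := by
  refine continuous_iff_continuousAt.mpr fun t => ?_
  have h : ContinuousAt F (u + t) :=
    (hF.differentiableAt (u + t) (by simpa using h0) (by simpa using h1)).continuousAt
  exact ContinuousAt.comp (f := fun t : ℝ => u + (t : ℂ)) h (by fun_prop)

theorem integrableOn_ray (hF : StripDecay F) {u : ℂ} (h0 : 0 < u.im) (h1 : u.im < Real.pi) :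
    MeasureTheory.IntegrableOn (fun t : ℝ => F (u + t)) (Set.Ioi 0) := by
  obtain ⟨η, hη, h2, h3⟩ := exists_margin h0 h1
  obtain ⟨C, hC⟩ := hF.bound η hη 1 one_pos le_rfl
  refine MeasureTheory.Integrable.mono'
    ((integrableOn_exp_mul_Ioi (by norm_num : (-1 : ℝ) < 0) 0).const_mul (C * Real.exp (-u.re)))
    (hF.continuous_ray h0 h1).aestronglyMeasurable ?_
  refine Eventually.of_forall fun t => ?_
  refine (hC _ (by simp; linarith) (by simp; linarith)).trans (le_of_eq ?_)
  rw [mul_assoc, ← Real.exp_add]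
  congr 2
  simp
  ring

theorem tendsto_ray (hF : StripDecay F) {u : ℂ} (h0 : 0 < u.im) (h1 : u.im < Real.pi) :
    Tendsto (fun t : ℝ => F (u + t)) atTop (𝓝 0) := by
  obtain ⟨η, hη, h2, h3⟩ := exists_margin h0 h1
  obtain ⟨C, hC⟩ := hF.bound η hη 1 one_pos le_rfl
  have hlim : Tendsto (fun t : ℝ => C * Real.exp (-u.re) * Real.exp (-t)) atTop
      (𝓝 (C * Real.exp (-u.re) * 0)) :=
    (Real.tendsto_exp_atBot.comp tendsto_neg_atTop_atBot).const_mul _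
  rw [mul_zero] at hlim
  refine squeeze_zero_norm (fun t => ?_) hlim
  refine (hC _ (by simp; linarith) (by simp; linarith)).trans (le_of_eq ?_)
  rw [mul_assoc, ← Real.exp_add]
  congr 2
  simp
  ring

theorem hasDerivAt_ray (hF : StripDecay F) {u : ℂ} (h0 : 0 < u.im) (h1 : u.im < Real.pi) (t : ℝ) :
    HasDerivAt (fun t : ℝ => F (u + t)) (deriv F (u + t)) t := by
  have h := (hF.differentiableAt (u + t) (by simpa using h0) (by simpa using h1)).hasDerivAt
  exact (h.comp_const_add u (t : ℂ)).comp_ofReal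

theorem tail_deriv (hF : StripDecay F) {u : ℂ} (h0 : 0 < u.im) (h1 : u.im < Real.pi) :
    tail (deriv F) u = -F u := by
  unfold tail
  rw [MeasureTheory.integral_Ioi_of_hasDerivAt_of_tendsto'
    (fun t _ => hF.hasDerivAt_ray h0 h1 t) (hF.deriv.integrableOn_ray h0 h1) (hF.tendsto_ray h0 h1)]
  simp

/-- Differentiation under the integral sign, dominated on a small disc by the decay of the
derivative; the integrated derivative is then a boundary term. -/
theorem hasDerivAt_tail (hF : StripDecay F) {u : ℂ} (h0 : 0 < u.im) (h1 : u.im < Real.pi) :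
    HasDerivAt (tail F) (-F u) u := by
  rw [← hF.tail_deriv h0 h1]
  obtain ⟨η, hη, h2, h3⟩ := exists_margin h0 h1
  obtain ⟨C, hC⟩ := hF.deriv.bound η hη 1 one_pos le_rfl
  have him : ∀ z ∈ Metric.ball u η, |z.im - u.im| < η ∧ |z.re - u.re| < η := by
    intro z hz
    rw [Metric.mem_ball, Complex.dist_eq] at hz
    exact ⟨(Complex.abs_im_le_norm (z - u)).trans_lt hz, (Complex.abs_re_le_norm (z - u)).trans_lt hz⟩
  have hC0 : 0 ≤ C := by
    have := (norm_nonneg _).trans (hC u (by linarith) (by linarith))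
    exact nonneg_of_mul_nonneg_left this (Real.exp_pos _)
  refine (hasDerivAt_integral_of_dominated_loc_of_deriv_le
    (F := fun w (t : ℝ) => F (w + t)) (F' := fun w (t : ℝ) => deriv F (w + t))
    (bound := fun t => C * Real.exp (-(u.re - η)) * Real.exp (-1 * t))
    (Metric.ball_mem_nhds u hη) ?_ (hF.integrableOn_ray h0 h1)
    (hF.deriv.continuous_ray h0 h1).aestronglyMeasurable ?_
    ((integrableOn_exp_mul_Ioi (by norm_num : (-1 : ℝ) < 0) 0).const_mul _) ?_).2
  · filter_upwards [isOpen_strip.mem_nhds (⟨h0, h1⟩ : u ∈ {u : ℂ | 0 < u.im ∧ u.im < Real.pi})]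
      with w hw
    exact (hF.continuous_ray hw.1 hw.2).aestronglyMeasurable
  · refine Eventually.of_forall fun t w hw => ?_
    have h4 := abs_lt.mp (him w hw).1
    have h5 := abs_lt.mp (him w hw).2
    refine (hC _ (by simp; linarith) (by simp; linarith)).trans ?_
    rw [mul_assoc, ← Real.exp_add]
    gcongr
    simp
    linarith
  · refine Eventually.of_forall fun t w hw => ?_
    have h4 := abs_lt.mp (him w hw).1
    have h := (hF.differentiableAt (w + t) (by simp; linarith) (by simp; linarith)).hasDerivAt
    exact h.comp_add_const w (t : ℂ)

theorem tail (hF : StripDecay F) : StripDecay (tail F) where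
  differentiableAt u h0 h1 := (hF.hasDerivAt_tail h0 h1).differentiableAt
  bound η hη c hc hc1 := by
    obtain ⟨C, hC⟩ := hF.bound η hη c hc hc1
    refine ⟨C / c, fun u h0 h1 => ?_⟩
    have hi := (integrableOn_exp_mul_Ioi (by linarith : -c < 0) 0).const_mul
      (C * Real.exp (-(c * u.re)))
    refine (MeasureTheory.norm_integral_le_of_norm_le hi (Eventually.of_forall fun t => ?_)).trans
      (le_of_eq ?_)
    · refine (hC (u + t) (by simpa using h0) (by simpa using h1)).trans (le_of_eq ?_)
      rw [mul_assoc, ← Real.exp_add]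
      congr 2
      simp
      ring
    · rw [MeasureTheory.integral_const_mul, integral_exp_mul_Ioi (by linarith)]
      simp
      field_simp

end StripDecay

/-! ### The function `psi` on the strip -/

theorem sinh_eq_add_mul_I (u : ℂ) : Complex.sinh u =
    ((Real.sinh u.re * Real.cos u.im : ℝ) : ℂ) + ((Real.cosh u.re * Real.sin u.im : ℝ) : ℂ) *
      Complex.I := by
  conv_lhs => rw [← Complex.re_add_im u, Complex.sinh_add, Complex.sinh_mul_I, Complex.cosh_mul_I]
  push_cast
  ring

theorem cosh_eq_add_mul_I (u : ℂ) : Complex.cosh u =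
    ((Real.cosh u.re * Real.cos u.im : ℝ) : ℂ) + ((Real.sinh u.re * Real.sin u.im : ℝ) : ℂ) *
      Complex.I := by
  conv_lhs => rw [← Complex.re_add_im u, Complex.cosh_add, Complex.sinh_mul_I, Complex.cosh_mul_I]
  push_cast
  ring

theorem sq_norm_sinh (u : ℂ) : ‖Complex.sinh u‖ ^ 2 = Real.sinh u.re ^ 2 + Real.sin u.im ^ 2 := by
  rw [← Complex.normSq_eq_norm_sq, sinh_eq_add_mul_I, Complex.normSq_add_mul_I]
  have h1 := Real.cosh_sq u.re
  have h2 := Real.sin_sq_add_cos_sq u.im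
  linear_combination (Real.sin u.im ^ 2) * h1 + Real.sinh u.re ^ 2 * h2

theorem sq_norm_cosh (u : ℂ) : ‖Complex.cosh u‖ ^ 2 = Real.sinh u.re ^ 2 + Real.cos u.im ^ 2 := by
  rw [← Complex.normSq_eq_norm_sq, cosh_eq_add_mul_I, Complex.normSq_add_mul_I]
  have h1 := Real.cosh_sq u.re
  have h2 := Real.sin_sq_add_cos_sq u.im
  linear_combination (Real.cos u.im ^ 2) * h1 + Real.sinh u.re ^ 2 * h2

theorem sinh_ne_zero_of_im {u : ℂ} (h0 : 0 < u.im) (h1 : u.im < Real.pi) : Complex.sinh u ≠ 0 := by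
  intro h
  have h2 := sq_norm_sinh u
  rw [h, norm_zero] at h2
  have := Real.sin_pos_of_pos_of_lt_pi h0 h1
  nlinarith [sq_nonneg (Real.sinh u.re)]

/-- From `|sinh u|² = sinh² (Re u) + sin² (Im u)` follows `|sinh u| ≥ sin η · cosh (Re u)`. -/
theorem stripDecay_inv_sinh : StripDecay fun u => (Complex.sinh u)⁻¹ where
  differentiableAt u h0 h1 :=
    (Complex.differentiable_sinh u).inv (sinh_ne_zero_of_im h0 h1)
  bound η hη c hc hc1 := by
    refine ⟨2 / Real.sin η, fun u h0 h1 => ?_⟩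
    have hs0 : 0 < Real.sin η := Real.sin_pos_of_pos_of_lt_pi hη (by linarith)
    have hs : Real.sin η ≤ Real.sin u.im := by
      rcases le_total u.im (Real.pi / 2) with h | h
      · exact Real.sin_le_sin_of_le_of_le_pi_div_two (by linarith) h h0
      · rw [← Real.sin_pi_sub u.im]
        exact Real.sin_le_sin_of_le_of_le_pi_div_two (by linarith) (by linarith) (by linarith)
    have hs1 := Real.sin_le_one η
    have hc0 := Real.cosh_pos u.re
    have h2 : Real.sin η * Real.cosh u.re ≤ ‖Complex.sinh u‖ := by
      refine le_of_sq_le_sq ?_ (norm_nonneg _)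
      rw [sq_norm_sinh, mul_pow, Real.cosh_sq]
      have : Real.sin η ^ 2 ≤ Real.sin u.im ^ 2 := by gcongr
      have h4 : Real.sin η ^ 2 * Real.sinh u.re ^ 2 ≤ Real.sinh u.re ^ 2 :=
        mul_le_of_le_one_left (sq_nonneg _) (pow_le_one₀ hs0.le hs1)
      linarith
    have h3 : Real.exp (c * u.re) ≤ 2 * Real.cosh u.re := by
      rw [Real.cosh_eq]
      rcases le_total 0 u.re with h | h
      · have : Real.exp (c * u.re) ≤ Real.exp u.re := Real.exp_le_exp.mpr (by nlinarith)
        linarith [Real.exp_pos (-u.re)]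
      · have : Real.exp (c * u.re) ≤ Real.exp (-u.re) := Real.exp_le_exp.mpr (by nlinarith)
        linarith [Real.exp_pos (u.re)]
    rw [norm_inv, Real.exp_neg, ← div_eq_mul_inv, ← one_div, div_div,
      div_le_div_iff₀ ((mul_pos hs0 hc0).trans_le h2) (by positivity)]
    nlinarith

theorem cosh_half_ne_zero {u : ℂ} (h0 : 0 < u.im) (h1 : u.im < Real.pi) :
    Complex.cosh (u / 2) ≠ 0 := by
  intro h
  have h2 := sq_norm_cosh (u / 2)
  rw [h, norm_zero] at h2
  have : 0 < Real.cos (u / 2).im := Real.cos_pos_of_mem_Ioo (by simp; constructor <;> linarith)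
  nlinarith [sq_nonneg (Real.sinh (u / 2).re)]

/-- This keeps `tanh (u/2)` off the branch cut of the logarithm and fixes the side from which the
cut is approached at the upper edge. -/
theorem im_tanh_half_pos {u : ℂ} (h0 : 0 < u.im) (h1 : u.im < Real.pi) :
    0 < (Complex.tanh (u / 2)).im := by
  have hc : 0 < Real.cos (u / 2).im := Real.cos_pos_of_mem_Ioo (by simp; constructor <;> linarith)
  have hs : 0 < Real.sin (u / 2).im :=
    Real.sin_pos_of_pos_of_lt_pi (by simp; linarith) (by simp; linarith)
  have hn : 0 < Complex.normSq (Complex.cosh (u / 2)) :=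
    Complex.normSq_pos.mpr (cosh_half_ne_zero h0 h1)
  rw [Complex.tanh_eq_sinh_div_cosh, Complex.div_im, ← sub_div]
  refine div_pos ?_ hn
  rw [sinh_eq_add_mul_I, cosh_eq_add_mul_I]
  simp only [Complex.add_re, Complex.add_im, Complex.ofReal_re, Complex.ofReal_im, Complex.mul_re,
    Complex.mul_im, Complex.I_re, Complex.I_im]
  have h2 := Real.cosh_sq (u / 2).re
  have : 0 < Real.sin (u / 2).im * Real.cos (u / 2).im := mul_pos hs hc
  have h3 : Real.cosh (u / 2).re ^ 2 * (Real.sin (u / 2).im * Real.cos (u / 2).im) -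
      Real.sinh (u / 2).re ^ 2 * (Real.sin (u / 2).im * Real.cos (u / 2).im) =
      Real.sin (u / 2).im * Real.cos (u / 2).im := by rw [h2]; ring
  nlinarith

theorem ctanh_half_mul {u : ℂ} (h : Complex.cosh (u / 2) ≠ 0) :
    Complex.tanh (u / 2) * (1 + Complex.exp (-u)) = 1 - Complex.exp (-u) := by
  rw [Complex.tanh_eq_sinh_div_cosh, div_mul_eq_mul_div, div_eq_iff h, Complex.sinh, Complex.cosh]
  have h1 : Complex.exp (-u) = Complex.exp (-(u / 2)) * Complex.exp (-(u / 2)) := by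
    rw [← Complex.exp_add]; ring_nf
  have h2 : Complex.exp (u / 2) * Complex.exp (-(u / 2)) = 1 := by
    rw [← Complex.exp_add]; simp
  rw [h1]
  linear_combination Complex.exp (-(u / 2)) * h2

/-- `-i log (tanh (u / 2))`. -/
noncomputable def psi (u : ℂ) : ℂ := -Complex.I * Complex.log (Complex.tanh (u / 2))

theorem hasDerivAt_psi {u : ℂ} (h0 : 0 < u.im) (h1 : u.im < Real.pi) :
    HasDerivAt psi (-(Complex.I * (Complex.sinh u)⁻¹)) u := by
  have hc := cosh_half_ne_zero h0 h1
  have him := im_tanh_half_pos h0 h1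
  have hs : Complex.sinh (u / 2) ≠ 0 := by
    intro h
    rw [Complex.tanh_eq_sinh_div_cosh, h, zero_div] at him
    exact lt_irrefl _ him
  have e : ∀ w : ℂ, Complex.tanh (w / 2) = Complex.sinh (w / 2) / Complex.cosh (w / 2) :=
    fun w => Complex.tanh_eq_sinh_div_cosh _
  have hh : HasDerivAt (fun w : ℂ => w / 2) (1 / 2) u := (hasDerivAt_id u).div_const 2
  have hd := (hh.csinh).div hh.ccosh hc
  have hslit : Complex.sinh (u / 2) / Complex.cosh (u / 2) ∈ Complex.slitPlane := by
    rw [← e]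
    exact Or.inr him.ne'
  have hd2 := (hd.clog hslit).const_mul (-Complex.I)
  have e2 : psi = fun w => -Complex.I * Complex.log (Complex.sinh (w / 2) / Complex.cosh (w / 2)) := by
    funext w
    rw [← e]
    rfl
  rw [e2]
  refine hd2.congr_deriv ?_
  have h3 := Complex.sinh_two_mul (u / 2)
  rw [mul_div_cancel₀ u two_ne_zero] at h3
  rw [h3, Pi.div_apply]
  have h4 := Complex.cosh_sq (u / 2)
  field_simp
  linear_combination -h4

theorem tendsto_psi_ray {u : ℂ} (h0 : 0 < u.im) (h1 : u.im < Real.pi) :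
    Tendsto (fun t : ℝ => psi (u + t)) atTop (𝓝 0) := by
  have h2 : Tendsto (fun t : ℝ => Complex.exp (-(u + t))) atTop (𝓝 0) := by
    rw [tendsto_zero_iff_norm_tendsto_zero]
    simp only [Complex.norm_exp, Complex.neg_re, Complex.add_re, Complex.ofReal_re]
    exact Real.tendsto_exp_atBot.comp
      (tendsto_neg_atTop_atBot.comp (tendsto_atTop_add_const_left _ _ tendsto_id))
  have h3 : Tendsto (fun t : ℝ => (1 - Complex.exp (-(u + t))) / (1 + Complex.exp (-(u + t)))) atTop
      (𝓝 ((1 - 0) / (1 + 0))) := (h2.const_sub 1).div (h2.const_add 1) (by norm_num)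
  rw [sub_zero, add_zero, div_one] at h3
  have h4 : ∀ᶠ t : ℝ in atTop, Complex.exp (-(u + t)) ≠ -1 := by
    have : (0 : ℂ) ≠ -1 := by norm_num
    exact h2.eventually_ne this
  have h5 : Tendsto (fun t : ℝ => Complex.tanh ((u + t) / 2)) atTop (𝓝 1) := by
    refine h3.congr' ?_
    filter_upwards [h4] with t ht
    rw [← ctanh_half_mul (cosh_half_ne_zero (by simpa using h0) (by simpa using h1)),
      mul_div_cancel_right₀]
    intro h
    exact ht (by linear_combination h)
  have h6 : ContinuousAt Complex.log 1 := continuousAt_clog (by simp)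
  have h7 := (h6.tendsto.comp h5).const_mul (-Complex.I)
  rw [Complex.log_one, mul_zero] at h7
  exact h7

/-- Both sides have the same derivative along the ray and vanish at its end. Hence `psi` inherits
the decay of `1/sinh`. -/
theorem psi_eq_tail {u : ℂ} (h0 : 0 < u.im) (h1 : u.im < Real.pi) :
    psi u = Complex.I * tail (fun u => (Complex.sinh u)⁻¹) u := by
  have h := MeasureTheory.integral_Ioi_of_hasDerivAt_of_tendsto' (a := (0 : ℝ))
    (f := fun t : ℝ => psi (u + t)) (fun t _ =>
      ((hasDerivAt_psi (u := u + t) (by simpa using h0) (by simpa using h1)).comp_const_add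
        u (t : ℂ)).comp_ofReal)
    ((stripDecay_inv_sinh.integrableOn_ray h0 h1).const_mul Complex.I).neg (tendsto_psi_ray h0 h1)
  rw [MeasureTheory.integral_neg, MeasureTheory.integral_const_mul] at h
  simp only [Complex.ofReal_zero, add_zero, zero_sub, neg_inj] at h
  exact h.symm

theorem stripDecay_psi : StripDecay psi where
  differentiableAt u h0 h1 := (hasDerivAt_psi h0 h1).differentiableAt
  bound η hη c hc hc1 := by
    obtain ⟨C, hC⟩ := (stripDecay_inv_sinh.tail.const_mul Complex.I).bound η hη c hc hc1
    refine ⟨C, fun u h0 h1 => ?_⟩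
    rw [psi_eq_tail (by linarith) (by linarith)]
    exact hC u h0 h1

/-- Along the ray `|sinh| ≥ sinh ∘ Re`, and the integral of `1/sinh` is `logCoth`. The bound is
uniform in `Im u`, as domination up to the edge of the strip requires. -/
theorem norm_psi_le_of_pos {u : ℂ} (h0 : 0 < u.im) (h1 : u.im < Real.pi) (hre : 0 < u.re) :
    ‖psi u‖ ≤ logCoth u.re := by
  have hd : ∀ t ∈ Set.Ici (0 : ℝ), HasDerivAt (fun t => -logCoth (u.re + t))
      (1 / Real.sinh (u.re + t)) t := fun t ht => by
    have ht' : (0 : ℝ) ≤ t := ht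
    have := ((hasDerivAt_logCoth (u := u.re + t) (by linarith)).comp_const_add u.re t).neg
    rwa [neg_neg] at this
  have hpos : ∀ t ∈ Set.Ioi (0 : ℝ), 0 ≤ 1 / Real.sinh (u.re + t) := fun t ht => by
    have ht' : (0 : ℝ) < t := ht
    have := Real.sinh_pos_iff.mpr (by linarith : 0 < u.re + t)
    positivity
  have hlim : Tendsto (fun t => -logCoth (u.re + t)) atTop (𝓝 (-0)) :=
    (tendsto_logCoth_atTop.comp (tendsto_atTop_add_const_left _ _ tendsto_id)).neg
  have hi := MeasureTheory.integrableOn_Ioi_deriv_of_nonneg' hd hpos hlim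
  have hv := MeasureTheory.integral_Ioi_of_hasDerivAt_of_nonneg' hd hpos hlim
  rw [psi_eq_tail h0 h1, norm_mul, Complex.norm_I, one_mul]
  simp only [add_zero, neg_zero, zero_sub, neg_neg] at hv
  rw [← hv]
  refine MeasureTheory.norm_integral_le_of_norm_le hi ?_
  refine (MeasureTheory.ae_restrict_iff' measurableSet_Ioi).mpr (Eventually.of_forall fun t ht => ?_)
  have ht' : (0 : ℝ) < t := ht
  have hs := Real.sinh_pos_iff.mpr (by linarith : 0 < u.re + t)
  rw [norm_inv, one_div]
  refine inv_anti₀ hs (le_of_sq_le_sq ?_ (norm_nonneg _))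
  rw [sq_norm_sinh]
  simp only [Complex.add_re, Complex.ofReal_re]
  linarith [sq_nonneg (Real.sin (u + t).im)]

/-- The argument of `tanh (u/2)` contributes at most `π`; its modulus lies between `tanh (-Re u/2)`
and the inverse of that number. -/
theorem norm_psi_le_of_neg {u : ℂ} (h0 : 0 < u.im) (h1 : u.im < Real.pi) (hre : u.re < 0) :
    ‖psi u‖ ≤ Real.pi + logCoth (-u.re) := by
  have hc := cosh_half_ne_zero h0 h1
  have hre' : 0 < -u.re := by linarith
  have htp := tanh_half_pos hre'
  have hsp : 0 < Real.sinh (-u.re / 2) := Real.sinh_pos_iff.mpr (by linarith)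
  have hcp := Real.cosh_pos (-u.re / 2)
  have hsq := Real.cosh_sq (-u.re / 2)
  have e1 : Real.sinh (u / 2).re ^ 2 = Real.sinh (-u.re / 2) ^ 2 := by
    have : (u / 2).re = -(-u.re / 2) := by simp; ring
    rw [this, Real.sinh_neg, neg_sq]
  have n1 := sq_norm_sinh (u / 2)
  have n2 := sq_norm_cosh (u / 2)
  rw [e1] at n1 n2
  have b1 := Real.sin_sq_add_cos_sq (u / 2).im
  have s0 := sq_nonneg (Real.sin (u / 2).im)
  have c0 := sq_nonneg (Real.cos (u / 2).im)
  have k1 : Real.sinh (-u.re / 2) ≤ ‖Complex.sinh (u / 2)‖ :=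
    le_of_sq_le_sq (by linarith) (norm_nonneg _)
  have k2 : ‖Complex.sinh (u / 2)‖ ≤ Real.cosh (-u.re / 2) := le_of_sq_le_sq (by linarith) hcp.le
  have k3 : Real.sinh (-u.re / 2) ≤ ‖Complex.cosh (u / 2)‖ :=
    le_of_sq_le_sq (by linarith) (norm_nonneg _)
  have k4 : ‖Complex.cosh (u / 2)‖ ≤ Real.cosh (-u.re / 2) := le_of_sq_le_sq (by linarith) hcp.le
  have ht : ‖Complex.tanh (u / 2)‖ = ‖Complex.sinh (u / 2)‖ / ‖Complex.cosh (u / 2)‖ := by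
    rw [Complex.tanh_eq_sinh_div_cosh, norm_div]
  have hlow : Real.tanh (-u.re / 2) ≤ ‖Complex.tanh (u / 2)‖ := by
    rw [ht, Real.tanh_eq_sinh_div_cosh]
    have := norm_pos_iff.mpr hc
    gcongr
  have hup : ‖Complex.tanh (u / 2)‖ ≤ (Real.tanh (-u.re / 2))⁻¹ := by
    rw [ht, Real.tanh_eq_sinh_div_cosh, inv_div]
    gcongr
  have hlog : |Real.log ‖Complex.tanh (u / 2)‖| ≤ logCoth (-u.re) := by
    rw [abs_le]
    constructor
    · unfold logCoth
      rw [neg_neg]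
      exact Real.log_le_log htp hlow
    · unfold logCoth
      rw [← Real.log_inv]
      exact Real.log_le_log (htp.trans_le hlow) hup
  rw [psi, norm_mul, norm_neg, Complex.norm_I, one_mul]
  refine (Complex.norm_le_abs_re_add_abs_im _).trans ?_
  rw [Complex.log_re, Complex.log_im]
  linarith [Complex.abs_arg_le_pi (Complex.tanh (u / 2))]

/-- Here `Im (u/2) = π/4`, where sine and cosine agree, so `|tanh (u/2)| = 1`. -/
theorem im_psi_midline (v : ℝ) : (psi (v + (Real.pi / 2 : ℝ) * Complex.I)).im = 0 := by
  set u : ℂ := v + (Real.pi / 2 : ℝ) * Complex.I with hu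
  have him : u.im = Real.pi / 2 := by simp [hu]
  have h0 : 0 < u.im := by rw [him]; positivity
  have h1 : u.im < Real.pi := by rw [him]; linarith [Real.pi_pos]
  have n1 := sq_norm_sinh (u / 2)
  have n2 := sq_norm_cosh (u / 2)
  have him2 : (u / 2).im = Real.pi / 4 := by
    rw [Complex.div_ofNat_im, him]; ring
  rw [him2, Real.sin_pi_div_four] at n1
  rw [him2, Real.cos_pi_div_four, ← n1] at n2
  have hc := norm_pos_iff.mpr (cosh_half_ne_zero h0 h1)
  have hn : ‖Complex.tanh (u / 2)‖ = 1 := by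
    rw [Complex.tanh_eq_sinh_div_cosh, norm_div, div_eq_one_iff_eq hc.ne']
    exact ((sq_eq_sq₀ (norm_nonneg _) (norm_nonneg _)).mp n2).symm
  rw [psi]
  simp [Complex.log_re, hn]

/-- Iterated tail integrals of `psi ^ (2 m) / (2 m)!`, preceded by its negated derivative. -/
noncomputable def psiTail (m : ℕ) : ℕ → ℂ → ℂ
  | 0 => fun u => ((2 * m - 1).factorial : ℂ)⁻¹ *
      (psi u ^ (2 * m - 1) * (Complex.I * (Complex.sinh u)⁻¹))
  | 1 => fun u => ((2 * m).factorial : ℂ)⁻¹ * psi u ^ (2 * m)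
  | l + 2 => tail (psiTail m (l + 1))

theorem stripDecay_psiTail {m : ℕ} (hm : 1 ≤ m) (l : ℕ) : StripDecay (psiTail m l) := by
  induction l with
  | zero =>
    obtain ⟨k, hk⟩ : ∃ k, 2 * m - 1 = k + 1 := ⟨2 * m - 2, by omega⟩
    have := ((stripDecay_psi.pow_succ k).mul
      (stripDecay_inv_sinh.const_mul Complex.I)).const_mul ((2 * m - 1).factorial : ℂ)⁻¹
    rw [← hk] at this
    exact this
  | succ l ih =>
    rcases l with _ | l
    · obtain ⟨k, hk⟩ : ∃ k, 2 * m = k + 1 := ⟨2 * m - 1, by omega⟩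
      have := (stripDecay_psi.pow_succ k).const_mul ((2 * m).factorial : ℂ)⁻¹
      rw [← hk] at this
      exact this
    · exact ih.tail

theorem hasDerivAt_psiTail {m : ℕ} (hm : 1 ≤ m) (l : ℕ) {u : ℂ} (h0 : 0 < u.im)
    (h1 : u.im < Real.pi) : HasDerivAt (psiTail m (l + 1)) (-psiTail m l u) u := by
  rcases l with _ | l
  · have h := ((hasDerivAt_psi h0 h1).pow (2 * m)).const_mul ((2 * m).factorial : ℂ)⁻¹
    refine h.congr_deriv ?_
    obtain ⟨k, hk⟩ : ∃ k, 2 * m = k + 1 := ⟨2 * m - 1, by omega⟩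
    simp only [psiTail]
    rw [hk, Nat.add_sub_cancel, Nat.factorial_succ]
    have h2 : (k.factorial : ℂ) ≠ 0 := Nat.cast_ne_zero.mpr (Nat.factorial_ne_zero k)
    have h3 : (k : ℂ) + 1 ≠ 0 := Nat.cast_add_one_ne_zero k
    push_cast
    field_simp
  · exact (stripDecay_psiTail hm (l + 1)).hasDerivAt_tail h0 h1

/-! ### Contour shift and the symmetric pairing -/

theorem integrable_of_integrableOn_Ioi {f : ℝ → ℝ}
    (h1 : MeasureTheory.IntegrableOn f (Set.Ioi 0))
    (h2 : MeasureTheory.IntegrableOn (fun v => f (-v)) (Set.Ioi 0)) : MeasureTheory.Integrable f := by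
  have h3 : MeasureTheory.IntegrableOn f (Set.Iio 0) := by
    have := (MeasureTheory.Measure.measurePreserving_neg
      (MeasureTheory.volume : MeasureTheory.Measure ℝ)).integrableOn_comp_preimage
      (Homeomorph.neg ℝ).measurableEmbedding (f := f) (s := Set.Iio 0)
    refine this.mp ?_
    have e : (Neg.neg : ℝ → ℝ) ⁻¹' Set.Iio 0 = Set.Ioi 0 := by
      ext v
      simp
    rw [e]
    exact h2
  have h4 : MeasureTheory.IntegrableOn f (Set.Iic 0) :=
    (integrableOn_Iic_iff_integrableOn_Iio).mpr h3
  rw [← MeasureTheory.integrableOn_univ, ← Set.Iic_union_Ioi (a := (0 : ℝ))]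
  exact h4.union h1

theorem integrable_exp_neg_half_abs :
    MeasureTheory.Integrable fun v : ℝ => Real.exp (-(|v| / 2)) := by
  have h : MeasureTheory.IntegrableOn (fun v : ℝ => Real.exp (-(|v| / 2))) (Set.Ioi 0) := by
    refine (integrableOn_exp_mul_Ioi (by norm_num : (-(1 / 2) : ℝ) < 0) 0).congr_fun
      (fun v hv => ?_) measurableSet_Ioi
    simp only
    rw [abs_of_pos hv]
    congr 1
    ring
  refine integrable_of_integrableOn_Ioi h ?_
  simpa only [abs_neg] using h

theorem tendsto_exp_neg_half_abs_atTop :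
    Tendsto (fun v : ℝ => Real.exp (-(|v| / 2))) atTop (𝓝 0) :=
  Real.tendsto_exp_atBot.comp (tendsto_neg_atTop_atBot.comp
    (tendsto_abs_atTop_atTop.atTop_div_const two_pos))

theorem tendsto_exp_neg_half_abs_atBot :
    Tendsto (fun v : ℝ => Real.exp (-(|v| / 2))) atBot (𝓝 0) :=
  Real.tendsto_exp_atBot.comp (tendsto_neg_atTop_atBot.comp
    (tendsto_abs_atBot_atTop.atTop_div_const two_pos))

theorem integrable_of_norm_le_exp {f : ℝ → ℂ} (hf : Continuous f) {K : ℝ}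
    (hK : ∀ v, ‖f v‖ ≤ K * Real.exp (-(|v| / 2))) : MeasureTheory.Integrable f :=
  MeasureTheory.Integrable.mono' (integrable_exp_neg_half_abs.const_mul K)
    hf.aestronglyMeasurable (Eventually.of_forall hK)

/-- Horizontal contour shift for functions decaying in both directions. -/
theorem integral_horizontal_eq {H : ℂ → ℂ} {a b K : ℝ} (hab : a ≤ b)
    (hd : ∀ u : ℂ, a ≤ u.im → u.im ≤ b → DifferentiableAt ℂ H u)
    (hK : ∀ u : ℂ, a ≤ u.im → u.im ≤ b → ‖H u‖ ≤ K * Real.exp (-(|u.re| / 2))) :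
    ∫ v : ℝ, H (v + a * Complex.I) = ∫ v : ℝ, H (v + b * Complex.I) := by
  have hint : ∀ y, a ≤ y → y ≤ b → MeasureTheory.Integrable fun v : ℝ => H (v + y * Complex.I) := by
    intro y h0 h1
    refine integrable_of_norm_le_exp (continuous_iff_continuousAt.mpr fun v => ?_) (K := K)
      fun v => ?_
    · exact ContinuousAt.comp (f := fun v : ℝ => (v : ℂ) + y * Complex.I)
        (hd _ (by simpa using h0) (by simpa using h1)).continuousAt (by fun_prop)
    · simpa using hK (v + y * Complex.I) (by simpa using h0) (by simpa using h1)
  have hrect : ∀ T : ℝ, 0 ≤ T → (∫ v : ℝ in -T..T, H (v + a * Complex.I)) -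
      (∫ v : ℝ in -T..T, H (v + b * Complex.I)) =
      Complex.I • (∫ y : ℝ in a..b, H ((-T : ℝ) + y * Complex.I)) -
      Complex.I • ∫ y : ℝ in a..b, H ((T : ℝ) + y * Complex.I) := by
    intro T hT
    have h := Complex.integral_boundary_rect_eq_zero_of_differentiableOn H
      ((-T : ℝ) + a * Complex.I) ((T : ℝ) + b * Complex.I) (fun u hu => by
        rw [Complex.mem_reProdIm] at hu
        have h2 := hu.2
        simp only [Complex.add_im, Complex.ofReal_im, Complex.mul_im, Complex.ofReal_re,
          Complex.I_im, mul_one, Complex.I_re, mul_zero, add_zero, zero_add,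
          Set.uIcc_of_le hab] at h2
        exact (hd u h2.1 h2.2).differentiableWithinAt)
    simp only [Complex.add_im, Complex.ofReal_im, Complex.mul_im, Complex.ofReal_re,
      Complex.I_im, mul_one, Complex.I_re, mul_zero, add_zero, zero_add, Complex.add_re,
      Complex.mul_re, sub_zero] at h
    linear_combination h
  have hvert : ∀ s : ℝ, ‖∫ y : ℝ in a..b, H ((s : ℝ) + y * Complex.I)‖ ≤
      K * Real.exp (-(|s| / 2)) * |b - a| := by
    intro s
    refine intervalIntegral.norm_integral_le_of_norm_le_const fun y hy => ?_
    rw [Set.uIoc_of_le hab] at hy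
    simpa using hK (s + y * Complex.I) (by simpa using hy.1.le) (by simpa using hy.2)
  have hv1 : Tendsto (fun T : ℝ => ∫ y : ℝ in a..b, H ((T : ℝ) + y * Complex.I)) atTop (𝓝 0) := by
    refine squeeze_zero_norm hvert ?_
    have := (tendsto_exp_neg_half_abs_atTop.const_mul K).mul_const |b - a|
    rwa [mul_zero, zero_mul] at this
  have hv2 : Tendsto (fun T : ℝ => ∫ y : ℝ in a..b, H ((-T : ℝ) + y * Complex.I)) atTop (𝓝 0) := by
    refine squeeze_zero_norm (fun T => hvert (-T)) ?_
    have := (tendsto_exp_neg_half_abs_atTop.const_mul K).mul_const |b - a|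
    simp only [abs_neg]
    rwa [mul_zero, zero_mul] at this
  have hlim := ((hv2.const_smul Complex.I).sub (hv1.const_smul Complex.I))
  rw [smul_zero, sub_zero] at hlim
  have hA := (MeasureTheory.intervalIntegral_tendsto_integral (hint a le_rfl hab)
    tendsto_neg_atTop_atBot tendsto_id).sub
    (MeasureTheory.intervalIntegral_tendsto_integral (hint b hab le_rfl)
    tendsto_neg_atTop_atBot tendsto_id)
  refine sub_eq_zero.mp (tendsto_nhds_unique (hA.congr' ?_) hlim)
  filter_upwards [eventually_ge_atTop 0] with T hT
  exact hrect T hT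

/-- The integrand of `pairing`, as a function on the strip `0 < Im z < π / 2`. -/
noncomputable def pairingFun (F G : ℂ → ℂ) (z : ℂ) : ℂ :=
  F (z + (Real.pi / 2 : ℝ) * Complex.I) * G ((Real.pi : ℝ) * Complex.I - z)

/-- The pairing of two functions along opposite horizontal lines. -/
noncomputable def pairing (F G : ℂ → ℂ) (ε : ℝ) : ℂ :=
  ∫ v : ℝ, pairingFun F G (v + ε * Complex.I)

/-- The two arguments run in opposite horizontal directions. The function moving to the right is
used at rate 1, the one moving to the left at rate 1/2, which leaves a decay of 1/2 at both ends. -/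
theorem exists_norm_pairingFun_le {F G : ℂ → ℂ} (hF : StripDecay F) (hG : StripDecay G) {η : ℝ}
    (hη : 0 < η) : ∃ K, ∀ z : ℂ, η ≤ z.im → z.im ≤ Real.pi / 2 - η →
      ‖pairingFun F G z‖ ≤ K * Real.exp (-(|z.re| / 2)) := by
  obtain ⟨C1, hC1⟩ := hF.bound η hη 1 one_pos le_rfl
  obtain ⟨C2, hC2⟩ := hF.bound η hη (1 / 2) (by norm_num) (by norm_num)
  obtain ⟨D1, hD1⟩ := hG.bound η hη 1 one_pos le_rfl
  obtain ⟨D2, hD2⟩ := hG.bound η hη (1 / 2) (by norm_num) (by norm_num)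
  refine ⟨max (C1 * D2) (C2 * D1), fun z h0 h1 => ?_⟩
  have hpi := Real.pi_pos
  have f0 : η ≤ (z + (Real.pi / 2 : ℝ) * Complex.I).im := by simp; linarith
  have f1 : (z + (Real.pi / 2 : ℝ) * Complex.I).im ≤ Real.pi - η := by simp; linarith
  have g0 : η ≤ ((Real.pi : ℝ) * Complex.I - z).im := by simp; linarith
  have g1 : ((Real.pi : ℝ) * Complex.I - z).im ≤ Real.pi - η := by simp; linarith
  have fre : (z + (Real.pi / 2 : ℝ) * Complex.I).re = z.re := by simp
  have gre : ((Real.pi : ℝ) * Complex.I - z).re = -z.re := by simp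
  unfold pairingFun
  rw [norm_mul]
  rcases le_total 0 z.re with h | h
  · refine (mul_le_mul (hC1 _ f0 f1) (hD2 _ g0 g1) (norm_nonneg _)
      ((norm_nonneg _).trans (hC1 _ f0 f1))).trans ?_
    rw [fre, gre, abs_of_nonneg h, mul_mul_mul_comm, ← Real.exp_add]
    refine mul_le_mul (le_max_left _ _) (le_of_eq ?_) (Real.exp_pos _).le ?_
    · congr 1
      ring
    · refine le_max_of_le_left (mul_nonneg ?_ ?_)
      · exact nonneg_of_mul_nonneg_left ((norm_nonneg _).trans (hC1 _ f0 f1)) (Real.exp_pos _)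
      · exact nonneg_of_mul_nonneg_left ((norm_nonneg _).trans (hD2 _ g0 g1)) (Real.exp_pos _)
  · refine (mul_le_mul (hC2 _ f0 f1) (hD1 _ g0 g1) (norm_nonneg _)
      ((norm_nonneg _).trans (hC2 _ f0 f1))).trans ?_
    rw [fre, gre, abs_of_nonpos h, mul_mul_mul_comm, ← Real.exp_add]
    refine mul_le_mul (le_max_right _ _) (le_of_eq ?_) (Real.exp_pos _).le ?_
    · congr 1
      ring
    · refine le_max_of_le_right (mul_nonneg ?_ ?_)
      · exact nonneg_of_mul_nonneg_left ((norm_nonneg _).trans (hC2 _ f0 f1)) (Real.exp_pos _)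
      · exact nonneg_of_mul_nonneg_left ((norm_nonneg _).trans (hD1 _ g0 g1)) (Real.exp_pos _)

theorem differentiableAt_pairingFun {F G : ℂ → ℂ} (hF : StripDecay F) (hG : StripDecay G) {z : ℂ}
    (h0 : 0 < z.im) (h1 : z.im < Real.pi / 2) : DifferentiableAt ℂ (pairingFun F G) z := by
  have hF' := hF.differentiableAt (z + (Real.pi / 2 : ℝ) * Complex.I)
    (by simp; positivity) (by simp; linarith)
  have hG' := hG.differentiableAt ((Real.pi : ℝ) * Complex.I - z)
    (by simp; linarith [Real.pi_pos]) (by simp; linarith)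
  exact (DifferentiableAt.comp (f := fun z => z + _) z hF' (by fun_prop)).mul (DifferentiableAt.comp z hG' (by fun_prop))

theorem continuous_pairingFun_line {F G : ℂ → ℂ} (hF : StripDecay F) (hG : StripDecay G) {ε : ℝ}
    (h0 : 0 < ε) (h1 : ε < Real.pi / 2) :
    Continuous fun v : ℝ => pairingFun F G (v + ε * Complex.I) :=
  continuous_iff_continuousAt.mpr fun v =>
    ContinuousAt.comp (f := fun v : ℝ => (v : ℂ) + ε * Complex.I)
      (differentiableAt_pairingFun hF hG (by simpa using h0) (by simpa using h1)).continuousAt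
      (by fun_prop)

theorem pairing_eq_of_le {F G : ℂ → ℂ} (hF : StripDecay F) (hG : StripDecay G) {a b : ℝ}
    (ha : 0 < a) (hab : a ≤ b) (hb : b < Real.pi / 2) : pairing F G a = pairing F G b := by
  obtain ⟨K, hK⟩ := exists_norm_pairingFun_le hF hG
    (lt_min ha (by linarith : 0 < Real.pi / 2 - b))
  refine integral_horizontal_eq hab (fun u h0 h1 => ?_) (K := K) (fun u h0 h1 => ?_)
  · exact differentiableAt_pairingFun hF hG (by linarith) (by linarith)
  · exact hK u (by linarith [min_le_left a (Real.pi / 2 - b)])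
      (by linarith [min_le_right a (Real.pi / 2 - b)])

theorem pairing_eq {F G : ℂ → ℂ} (hF : StripDecay F) (hG : StripDecay G) {a b : ℝ}
    (ha : 0 < a) (ha' : a < Real.pi / 2) (hb : 0 < b) (hb' : b < Real.pi / 2) :
    pairing F G a = pairing F G b := by
  rcases le_total a b with h | h
  · exact pairing_eq_of_le hF hG ha h hb'
  · exact (pairing_eq_of_le hF hG hb h ha').symm

/-- The reflection `z ↦ iπ/2 - z` interchanges `z + iπ/2` and `iπ - z`. -/
theorem pairing_comm (F G : ℂ → ℂ) (ε : ℝ) : pairing F G ε = pairing G F (Real.pi / 2 - ε) := by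
  unfold pairing
  rw [← MeasureTheory.integral_neg_eq_self]
  refine MeasureTheory.integral_congr_ae (Eventually.of_forall fun v => ?_)
  simp only [pairingFun]
  rw [mul_comm]
  congr 2
  · push_cast
    ring
  · push_cast
    ring

/-- The second argument is reversed, so the two derivative terms have opposite signs and the
boundary terms vanish by decay. -/
theorem pairing_by_parts {F G f g : ℂ → ℂ} (hF : StripDecay F) (hG : StripDecay G)
    (hf : StripDecay f) (hg : StripDecay g)
    (hFf : ∀ u : ℂ, 0 < u.im → u.im < Real.pi → HasDerivAt F (-f u) u)
    (hGg : ∀ u : ℂ, 0 < u.im → u.im < Real.pi → HasDerivAt G (-g u) u) {ε : ℝ}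
    (h0 : 0 < ε) (h1 : ε < Real.pi / 2) : pairing f G ε = pairing F g ε := by
  have hη : 0 < min ε (Real.pi / 2 - ε) := lt_min h0 (by linarith)
  have hl := min_le_left ε (Real.pi / 2 - ε)
  have hr := min_le_right ε (Real.pi / 2 - ε)
  have hbound : ∀ {A B : ℂ → ℂ}, StripDecay A → StripDecay B → ∃ K, ∀ v : ℝ,
      ‖pairingFun A B (v + ε * Complex.I)‖ ≤ K * Real.exp (-(|v| / 2)) := by
    intro A B hA hB
    obtain ⟨K, hK⟩ := exists_norm_pairingFun_le hA hB hη
    refine ⟨K, fun v => ?_⟩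
    have := hK (v + ε * Complex.I) (by simp) (by simp; linarith)
    simpa using this
  have hint : ∀ {A B : ℂ → ℂ}, StripDecay A → StripDecay B →
      MeasureTheory.Integrable fun v : ℝ => pairingFun A B (v + ε * Complex.I) := by
    intro A B hA hB
    obtain ⟨K, hK⟩ := hbound hA hB
    exact integrable_of_norm_le_exp (continuous_pairingFun_line hA hB h0 h1) hK
  have hderiv : ∀ v : ℝ, HasDerivAt (fun v : ℝ => pairingFun F G (v + ε * Complex.I))
      (pairingFun F g (v + ε * Complex.I) - pairingFun f G (v + ε * Complex.I)) v := by
    intro v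
    have d1 := (hFf ((v : ℂ) + (ε * Complex.I + (Real.pi / 2 : ℝ) * Complex.I))
      (by simp; linarith [Real.pi_pos]) (by simp; linarith)).comp_add_const (v : ℂ) _
    have d2 := (hGg (((Real.pi : ℝ) * Complex.I - ε * Complex.I) - (v : ℂ))
      (by simp; linarith [Real.pi_pos]) (by simp; linarith)).comp_const_sub _ (v : ℂ)
    have d3 := (d1.mul d2).comp_ofReal
    refine (d3.congr_deriv ?_).congr_of_eventuallyEq (Eventually.of_forall fun w => ?_)
    · simp only [pairingFun]
      rw [show (v : ℂ) + ε * Complex.I + (Real.pi / 2 : ℝ) * Complex.I =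
        (v : ℂ) + (ε * Complex.I + (Real.pi / 2 : ℝ) * Complex.I) by ring,
        show (Real.pi : ℝ) * Complex.I - ((v : ℂ) + ε * Complex.I) =
        ((Real.pi : ℝ) * Complex.I - ε * Complex.I) - (v : ℂ) by ring]
      ring
    · simp only [pairingFun, Pi.mul_apply]
      congr 2 <;> ring
  obtain ⟨K, hK⟩ := hbound hF hG
  have ht := tendsto_exp_neg_half_abs_atTop.const_mul K
  have hb := tendsto_exp_neg_half_abs_atBot.const_mul K
  rw [mul_zero] at ht hb
  have h := MeasureTheory.integral_of_hasDerivAt_of_tendsto hderiv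
    ((hint hF hg).sub (hint hf hG)) (squeeze_zero_norm hK hb) (squeeze_zero_norm hK ht)
  rw [MeasureTheory.integral_sub (hint hF hg) (hint hf hG), sub_zero, sub_eq_zero] at h
  exact h.symm

theorem pairing_psiTail_shift {m p : ℕ} (hm : 1 ≤ m) (hp : 1 ≤ p) (a b k : ℕ) {ε : ℝ}
    (h0 : 0 < ε) (h1 : ε < Real.pi / 2) :
    pairing (psiTail m (a + k)) (psiTail p b) ε = pairing (psiTail m a) (psiTail p (b + k)) ε := by
  induction k generalizing a with
  | zero => rfl
  | succ k ih =>
    rw [show a + (k + 1) = a + 1 + k by ring, ih (a + 1)]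
    exact (pairing_by_parts (stripDecay_psiTail hm _) (stripDecay_psiTail hp _)
      (stripDecay_psiTail hm _) (stripDecay_psiTail hp _)
      (fun u => hasDerivAt_psiTail hm a) (fun u => hasDerivAt_psiTail hp (b + k)) h0 h1).symm

theorem pairing_psiTail_symm {m p : ℕ} (hm : 1 ≤ m) (hp : 1 ≤ p) (l : ℕ) {ε : ℝ}
    (h0 : 0 < ε) (h1 : ε < Real.pi / 2) :
    pairing (psiTail m l) (psiTail p 1) ε = pairing (psiTail p l) (psiTail m 1) ε := by
  have h2 : pairing (psiTail m l) (psiTail p 1) ε = pairing (psiTail m 1) (psiTail p l) ε := by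
    -- For `l = 0` the transfer goes the other way, because index 0 lies one derivative below index
    -- 1.
    rcases l with _ | l
    · exact (pairing_psiTail_shift hm hp 0 0 1 h0 h1).symm
    · have := pairing_psiTail_shift hm hp 1 1 l h0 h1
      rwa [add_comm 1 l] at this
  rw [h2, pairing_comm]
  exact pairing_eq (stripDecay_psiTail hp _) (stripDecay_psiTail hm _) (by linarith) (by linarith)
    h0 h1

/-! ### Real functions on the midline -/

/-- The restriction of `psi` to the line `Im u = π / 2`. -/
noncomputable def phi (v : ℝ) : ℝ := (psi (v + (Real.pi / 2 : ℝ) * Complex.I)).re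

theorem psi_midline (v : ℝ) : psi (v + (Real.pi / 2 : ℝ) * Complex.I) = phi v :=
  Complex.ext rfl (by rw [im_psi_midline, Complex.ofReal_im])

/-- The restriction of `psiTail` to the line `Im u = π / 2`. -/
noncomputable def phiTail (m l : ℕ) (v : ℝ) : ℝ :=
  (psiTail m l (v + (Real.pi / 2 : ℝ) * Complex.I)).re

theorem im_midline_pos (v : ℝ) : 0 < ((v : ℂ) + (Real.pi / 2 : ℝ) * Complex.I).im := by
  simp [Real.pi_pos]

theorem im_midline_lt (v : ℝ) : ((v : ℂ) + (Real.pi / 2 : ℝ) * Complex.I).im < Real.pi := by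
  simp only [Complex.add_im, Complex.ofReal_im, Complex.mul_im, Complex.ofReal_re, Complex.I_im,
    mul_one, Complex.I_re, mul_zero, add_zero, zero_add]
  linarith [Real.pi_pos]

theorem inv_sinh_midline (v : ℝ) :
    Complex.I * (Complex.sinh (v + (Real.pi / 2 : ℝ) * Complex.I))⁻¹ =
      ((1 / Real.cosh v : ℝ) : ℂ) := by
  rw [sinh_eq_add_mul_I]
  simp only [Complex.add_re, Complex.ofReal_re, Complex.mul_re, Complex.I_re, mul_zero,
    Complex.ofReal_im, Complex.I_im, mul_one, sub_self, add_zero, Complex.add_im, Complex.mul_im,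
    zero_add, Real.cos_pi_div_two, Real.sin_pi_div_two, Complex.ofReal_zero]
  have : (Real.cosh v : ℂ) ≠ 0 := Complex.ofReal_ne_zero.mpr (Real.cosh_pos v).ne'
  push_cast at this ⊢
  field_simp

theorem phiTail_zero (m : ℕ) (v : ℝ) :
    phiTail m 0 v = phi v ^ (2 * m - 1) / ((2 * m - 1).factorial : ℝ) * (1 / Real.cosh v) := by
  unfold phiTail psiTail
  rw [psi_midline, inv_sinh_midline]
  rw [← Complex.ofReal_natCast, ← Complex.ofReal_inv, ← Complex.ofReal_pow, ← Complex.ofReal_mul,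
    ← Complex.ofReal_mul, Complex.ofReal_re]
  ring

theorem phiTail_one (m : ℕ) (v : ℝ) :
    phiTail m 1 v = phi v ^ (2 * m) / ((2 * m).factorial : ℝ) := by
  unfold phiTail psiTail
  rw [psi_midline]
  rw [← Complex.ofReal_natCast, ← Complex.ofReal_inv, ← Complex.ofReal_pow, ← Complex.ofReal_mul,
    Complex.ofReal_re]
  ring

theorem im_psiTail_midline {m : ℕ} (hm : 1 ≤ m) (l : ℕ) (v : ℝ) :
    (psiTail m l (v + (Real.pi / 2 : ℝ) * Complex.I)).im = 0 := by
  induction l generalizing v with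
  | zero =>
    unfold psiTail
    rw [psi_midline, inv_sinh_midline]
    rw [← Complex.ofReal_natCast, ← Complex.ofReal_inv, ← Complex.ofReal_pow, ← Complex.ofReal_mul,
      ← Complex.ofReal_mul, Complex.ofReal_im]
  | succ l ih =>
    rcases l with _ | l
    · unfold psiTail
      rw [psi_midline]
      rw [← Complex.ofReal_natCast, ← Complex.ofReal_inv, ← Complex.ofReal_pow,
        ← Complex.ofReal_mul, Complex.ofReal_im]
    · have h := integral_im ((stripDecay_psiTail hm (l + 1)).integrableOn_ray (im_midline_pos v)
        (im_midline_lt v))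
      have e : ∀ t : ℝ, RCLike.im (psiTail m (l + 1) ((v : ℂ) + (Real.pi / 2 : ℝ) * Complex.I + t)) =
          0 := by
        intro t
        have := ih (v + t)
        rw [Complex.ofReal_add, add_right_comm] at this
        exact this
      simp only [e, MeasureTheory.integral_zero] at h
      exact h.symm

theorem psiTail_midline {m : ℕ} (hm : 1 ≤ m) (l : ℕ) (v : ℝ) :
    psiTail m l (v + (Real.pi / 2 : ℝ) * Complex.I) = phiTail m l v :=
  Complex.ext rfl (by rw [im_psiTail_midline hm, Complex.ofReal_im])

theorem hasDerivAt_re_midline {F : ℂ → ℂ} {F' : ℂ} {v : ℝ}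
    (h : HasDerivAt F F' (v + (Real.pi / 2 : ℝ) * Complex.I)) :
    HasDerivAt (fun v : ℝ => (F (v + (Real.pi / 2 : ℝ) * Complex.I)).re) F'.re v := by
  have h2 := (h.comp_add_const (v : ℂ) _).comp_ofReal
  exact Complex.reCLM.hasFDerivAt.comp_hasDerivAt v h2

theorem hasDerivAt_phi (v : ℝ) : HasDerivAt phi (-(1 / Real.cosh v)) v := by
  have h := hasDerivAt_re_midline (hasDerivAt_psi (im_midline_pos v) (im_midline_lt v))
  rw [inv_sinh_midline, Complex.neg_re, Complex.ofReal_re] at h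
  exact h

theorem hasDerivAt_phiTail {m : ℕ} (hm : 1 ≤ m) (l : ℕ) (v : ℝ) :
    HasDerivAt (phiTail m (l + 1)) (-phiTail m l v) v :=
  hasDerivAt_re_midline (hasDerivAt_psiTail hm l (im_midline_pos v) (im_midline_lt v))

theorem exists_abs_re_midline_le {F : ℂ → ℂ} (hF : StripDecay F) :
    ∃ C, ∀ v : ℝ, |(F (v + (Real.pi / 2 : ℝ) * Complex.I)).re| ≤ C * Real.exp (-v) := by
  obtain ⟨C, hC⟩ := hF.bound (Real.pi / 2) (by positivity) 1 one_pos le_rfl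
  refine ⟨C, fun v => (Complex.abs_re_le_norm _).trans ?_⟩
  have := hC (v + (Real.pi / 2 : ℝ) * Complex.I) (by simp) (by simp; linarith)
  simpa using this

theorem continuous_phiTail {m : ℕ} (hm : 1 ≤ m) (l : ℕ) : Continuous (phiTail m l) := by
  refine Complex.continuous_re.comp (continuous_iff_continuousAt.mpr fun v => ?_)
  exact ContinuousAt.comp (f := fun v : ℝ => (v : ℂ) + (Real.pi / 2 : ℝ) * Complex.I)
    ((stripDecay_psiTail hm l).differentiableAt _ (im_midline_pos v) (im_midline_lt v)).continuousAt
    (by fun_prop)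

/-! ### Boundary values on the upper edge -/

theorem sinh_upper_edge (v : ℝ) :
    Complex.sinh (((Real.pi : ℝ) * Complex.I - v) / 2) = Complex.I * (Real.cosh (v / 2) : ℝ) := by
  rw [sinh_eq_add_mul_I]
  have h1 : (((Real.pi : ℝ) * Complex.I - v) / 2).re = -(v / 2) := by simp; ring
  have h2 : (((Real.pi : ℝ) * Complex.I - v) / 2).im = Real.pi / 2 := by simp
  rw [h1, h2, Real.cos_pi_div_two, Real.sin_pi_div_two, Real.cosh_neg]
  simp [mul_comm]

theorem cosh_upper_edge (v : ℝ) :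
    Complex.cosh (((Real.pi : ℝ) * Complex.I - v) / 2) = -Complex.I * (Real.sinh (v / 2) : ℝ) := by
  rw [cosh_eq_add_mul_I]
  have h1 : (((Real.pi : ℝ) * Complex.I - v) / 2).re = -(v / 2) := by simp; ring
  have h2 : (((Real.pi : ℝ) * Complex.I - v) / 2).im = Real.pi / 2 := by simp
  rw [h1, h2, Real.cos_pi_div_two, Real.sin_pi_div_two, Real.sinh_neg]
  simp [mul_comm]

theorem ctanh_upper_edge {v : ℝ} (hv : v ≠ 0) :
    Complex.tanh (((Real.pi : ℝ) * Complex.I - v) / 2) = ((-(Real.tanh (v / 2))⁻¹ : ℝ) : ℂ) := by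
  have hs : (Real.sinh (v / 2) : ℂ) ≠ 0 := by
    rw [Complex.ofReal_ne_zero]
    simpa using hv
  have hc : (Real.cosh (v / 2) : ℂ) ≠ 0 := Complex.ofReal_ne_zero.mpr (Real.cosh_pos _).ne'
  rw [Complex.tanh_eq_sinh_div_cosh, sinh_upper_edge, cosh_upper_edge, Real.tanh_eq_sinh_div_cosh]
  push_cast at hs hc ⊢
  field_simp

theorem tendsto_ctanh_upper_edge {v : ℝ} (hv : v ≠ 0) :
    Tendsto (fun ε : ℝ => Complex.tanh (((Real.pi : ℝ) * Complex.I - (v + ε * Complex.I)) / 2))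
      (𝓝[>] 0) (𝓝 ((-(Real.tanh (v / 2))⁻¹ : ℝ) : ℂ)) := by
  rw [← ctanh_upper_edge hv]
  have hc : Complex.cosh (((Real.pi : ℝ) * Complex.I - v) / 2) ≠ 0 := by
    rw [cosh_upper_edge]
    refine mul_ne_zero (neg_ne_zero.mpr Complex.I_ne_zero) ?_
    rw [Complex.ofReal_ne_zero]
    simpa using hv
  have h : Continuous fun ε : ℝ => ((Real.pi : ℝ) * Complex.I - (v + ε * Complex.I)) / 2 := by
    fun_prop
  have h0 := h.tendsto 0
  simp only [Complex.ofReal_zero, zero_mul, add_zero] at h0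
  simp only [Complex.tanh_eq_sinh_div_cosh]
  exact (((Complex.differentiable_sinh _).continuousAt.tendsto.comp h0).div
    ((Complex.differentiable_cosh _).continuousAt.tendsto.comp h0) hc).mono_left nhdsWithin_le_nhds

/-- Boundary values of `psi` on the line `Im u = π`, at the point `i π - v`. -/
noncomputable def edge (v : ℝ) : ℂ :=
  if 0 < v then (Real.pi : ℝ) - Complex.I * (logCoth v : ℝ) else -Complex.I * (logCoth (-v) : ℝ)

theorem tendsto_psi_upper_edge {v : ℝ} (hv : v ≠ 0) :
    Tendsto (fun ε : ℝ => psi ((Real.pi : ℝ) * Complex.I - (v + ε * Complex.I))) (𝓝[>] 0)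
      (𝓝 (edge v)) := by
  have ht := tendsto_ctanh_upper_edge hv
  rcases lt_or_gt_of_ne hv with h | h
  · have hT := tanh_half_pos (neg_pos.mpr h)
    have e : -(Real.tanh (v / 2))⁻¹ = (Real.tanh (-v / 2))⁻¹ := by
      rw [neg_div, Real.tanh_neg, inv_neg]
    rw [e] at ht
    have hc : ContinuousAt Complex.log (((Real.tanh (-v / 2))⁻¹ : ℝ) : ℂ) :=
      continuousAt_clog (Complex.ofReal_mem_slitPlane.mpr (inv_pos.mpr hT))
    have h2 := (hc.tendsto.comp ht).const_mul (-Complex.I)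
    rw [← Complex.ofReal_log (inv_pos.mpr hT).le, Real.log_inv] at h2
    rw [edge, if_neg (not_lt.mpr h.le)]
    exact h2
  · have hT := tanh_half_pos h
    have hneg : -(Real.tanh (v / 2))⁻¹ < 0 := neg_neg_of_pos (inv_pos.mpr hT)
    -- For `v > 0` the limit of `tanh` lies on the branch cut. It is approached from the upper
    -- half-plane, so the argument tends to `π`; this is the source of the `π` in `edge`.
    have hc : ContinuousWithinAt Complex.log {z : ℂ | 0 ≤ z.im}
        ((-(Real.tanh (v / 2))⁻¹ : ℝ) : ℂ) :=
      Complex.continuousWithinAt_log_of_re_neg_of_im_zero (by rwa [Complex.ofReal_re])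
        (Complex.ofReal_im _)
    have ht2 : Tendsto (fun ε : ℝ =>
        Complex.tanh (((Real.pi : ℝ) * Complex.I - (v + ε * Complex.I)) / 2))
        (𝓝[>] 0) (𝓝[{z : ℂ | 0 ≤ z.im}] ((-(Real.tanh (v / 2))⁻¹ : ℝ) : ℂ)) := by
      refine tendsto_nhdsWithin_iff.mpr ⟨ht, ?_⟩
      filter_upwards [Ioo_mem_nhdsGT Real.pi_pos] with ε hε
      exact (im_tanh_half_pos (by simp; exact hε.2) (by simp; exact hε.1)).le
    have h2 := (hc.tendsto.comp ht2).const_mul (-Complex.I)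
    have e : -Complex.I * Complex.log ((-(Real.tanh (v / 2))⁻¹ : ℝ) : ℂ) = edge v := by
      rw [edge, if_pos h, Complex.log, Complex.arg_ofReal_of_neg hneg, Complex.norm_real,
        Real.norm_eq_abs, abs_neg, abs_of_pos (inv_pos.mpr hT), Real.log_inv]
      unfold logCoth
      linear_combination (-(Real.pi : ℂ)) * Complex.I_mul_I
    rw [e] at h2
    exact h2

theorem norm_psi_upper_le {v ε : ℝ} (hv : v ≠ 0) (h0 : 0 < ε) (h1 : ε < Real.pi) :
    ‖psi ((Real.pi : ℝ) * Complex.I - (v + ε * Complex.I))‖ ≤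
      if 0 < v then Real.pi + logCoth v else logCoth (-v) := by
  set w := (Real.pi : ℝ) * Complex.I - (v + ε * Complex.I) with hw
  have hre : w.re = -v := by simp [hw]
  have him : w.im = Real.pi - ε := by simp [hw]
  split_ifs with h
  · have := norm_psi_le_of_neg (u := w) (by rw [him]; linarith) (by rw [him]; linarith)
      (by rw [hre]; linarith)
    rwa [hre, neg_neg] at this
  · have h2 : v < 0 := lt_of_le_of_ne (not_lt.mp h) hv
    have := norm_psi_le_of_pos (u := w) (by rw [him]; linarith) (by rw [him]; linarith)
      (by rw [hre]; linarith)
    rwa [hre] at this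

theorem im_edge_pow_of_neg (p : ℕ) {v : ℝ} (hv : v ≤ 0) : (edge v ^ (2 * p)).im = 0 := by
  rw [edge, if_neg (not_lt.mpr hv), pow_mul]
  have : (-Complex.I * (logCoth (-v) : ℝ)) ^ 2 = ((-(logCoth (-v) ^ 2) : ℝ) : ℂ) := by
    rw [mul_pow, neg_sq, Complex.I_sq]
    push_cast
    ring
  rw [this, ← Complex.ofReal_pow, Complex.ofReal_im]

theorem integrableOn_const_add_logCoth_pow (c : ℝ) (k : ℕ) :
    MeasureTheory.IntegrableOn (fun u : ℝ => (c + logCoth u) ^ k * Real.exp (-u)) (Set.Ioi 0) := by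
  have e : ∀ u, (c + logCoth u) ^ k * Real.exp (-u) =
      ∑ i ∈ Finset.range (k + 1), c ^ i * (k.choose i : ℝ) *
        (logCoth u ^ (k - i) * Real.exp (-u)) := by
    intro u
    rw [add_pow, Finset.sum_mul]
    exact Finset.sum_congr rfl fun i _ => by ring
  simp_rw [e]
  exact MeasureTheory.integrable_finsetSum _ fun i _ =>
    (integrableOn_logCoth_pow_mul_exp (k - i)).const_mul _

/-- Dominated convergence. For `v > 0` the decay of `F` tames the bound `π + logCoth v` on `psi`;
for `v < 0` the function `F` may grow like `exp (|v|/2)`, which the at least two powers of `logCoth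
(-v)` compensate. -/
theorem tendsto_im_pairing {F : ℂ → ℂ} (hF : StripDecay F) {p : ℕ} (hp : 1 ≤ p) :
    Tendsto (fun ε => (pairing F (psiTail p 1) ε).im) (𝓝[>] 0)
      (𝓝 (∫ v : ℝ, (F (v + (Real.pi / 2 : ℝ) * Complex.I) *
        (((2 * p).factorial : ℂ)⁻¹ * edge v ^ (2 * p))).im)) := by
  have hpi := Real.pi_pos
  obtain ⟨C1, hC1⟩ := hF.bound (Real.pi / 4) (by positivity) 1 one_pos le_rfl
  obtain ⟨C2, hC2⟩ := hF.bound (Real.pi / 4) (by positivity) (1 / 2) (by norm_num) (by norm_num)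
  set N : ℝ := ((2 * p).factorial : ℝ)⁻¹ with hN
  have hN0 : 0 ≤ N := by positivity
  set bound : ℝ → ℝ := fun v =>
    if 0 < v then C1 * Real.exp (-v) * (N * (Real.pi + logCoth v) ^ (2 * p))
    else C2 * Real.exp (-v / 2) * (N * logCoth (-v) ^ (2 * p)) with hbound
  have hε : ∀ᶠ ε : ℝ in 𝓝[>] 0, 0 < ε ∧ ε < Real.pi / 4 :=
    Ioo_mem_nhdsGT (by positivity)
  have him : ∀ᶠ ε : ℝ in 𝓝[>] 0, ∫ v : ℝ, (pairingFun F (psiTail p 1) (v + ε * Complex.I)).im =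
      (pairing F (psiTail p 1) ε).im := by
    filter_upwards [hε] with ε hε
    obtain ⟨K, hK⟩ := exists_norm_pairingFun_le hF (stripDecay_psiTail hp 1) hε.1
    exact integral_im (integrable_of_norm_le_exp (continuous_pairingFun_line hF
      (stripDecay_psiTail hp 1) hε.1 (by linarith [hε.2])) (K := K) fun v => by
        simpa using hK (v + ε * Complex.I) (by simp) (by simp; linarith [hε.2]))
  refine Tendsto.congr' him ?_
  refine MeasureTheory.tendsto_integral_filter_of_dominated_convergence bound ?_ ?_ ?_ ?_
  · filter_upwards [hε] with ε hε
    exact (Complex.continuous_im.comp (continuous_pairingFun_line hF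
      (stripDecay_psiTail hp 1) hε.1 (by linarith [hε.2]))).aestronglyMeasurable
  · filter_upwards [hε] with ε hε
    have hne : ∀ᵐ v : ℝ, v ≠ 0 := MeasureTheory.Measure.ae_ne _ 0
    filter_upwards [hne] with v hv
    refine (Complex.abs_im_le_norm _).trans ?_
    unfold pairingFun
    have f0 : Real.pi / 4 ≤ ((v : ℂ) + ε * Complex.I + (Real.pi / 2 : ℝ) * Complex.I).im := by
      simp; linarith [hε.1]
    have f1 : ((v : ℂ) + ε * Complex.I + (Real.pi / 2 : ℝ) * Complex.I).im ≤
        Real.pi - Real.pi / 4 := by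
      simp; linarith [hε.2]
    have g1 := hC1 _ f0 f1
    have g2 := hC2 _ f0 f1
    have hre : ((v : ℂ) + ε * Complex.I + (Real.pi / 2 : ℝ) * Complex.I).re = v := by simp
    rw [hre] at g1 g2
    have hpsi := norm_psi_upper_le hv hε.1 (by linarith [hε.2])
    have e : ‖psiTail p 1 ((Real.pi : ℝ) * Complex.I - (v + ε * Complex.I))‖ =
        N * ‖psi ((Real.pi : ℝ) * Complex.I - (v + ε * Complex.I))‖ ^ (2 * p) := by
      simp only [psiTail]
      rw [norm_mul, norm_pow, norm_inv, RCLike.norm_natCast]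
    rw [norm_mul, e]
    simp only [hbound]
    split_ifs at hpsi ⊢ with h
    · rw [one_mul] at g1
      refine mul_le_mul g1 ?_ (by positivity) ((norm_nonneg _).trans g1)
      gcongr
    · rw [show -(1 / 2 * v) = -v / 2 by ring] at g2
      refine mul_le_mul g2 ?_ (by positivity) ((norm_nonneg _).trans g2)
      gcongr
  · refine integrable_of_integrableOn_Ioi ?_ ?_
    · refine MeasureTheory.IntegrableOn.congr_fun
        ((integrableOn_const_add_logCoth_pow Real.pi (2 * p)).const_mul (C1 * N)) (fun v hv => ?_) measurableSet_Ioi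
      simp only [hbound]
      rw [if_pos (Set.mem_Ioi.mp hv)]
      ring
    · obtain ⟨k, hk⟩ : ∃ k, 2 * p = k + 2 := ⟨2 * p - 2, by omega⟩
      refine MeasureTheory.IntegrableOn.congr_fun
        ((integrableOn_logCoth_pow_mul_exp_half k).const_mul (C2 * N)) (fun v hv => ?_) measurableSet_Ioi
      have hv' : 0 < v := hv
      simp only [hbound]
      rw [if_neg (by linarith), neg_neg, hk]
      ring
  · have hne : ∀ᵐ v : ℝ, v ≠ 0 := MeasureTheory.Measure.ae_ne _ 0
    filter_upwards [hne] with v hv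
    refine (Complex.continuous_im.tendsto _).comp (Tendsto.mul ?_ ?_)
    · have hc : ContinuousAt F ((v : ℂ) + (Real.pi / 2 : ℝ) * Complex.I) :=
        (hF.differentiableAt _ (im_midline_pos v) (im_midline_lt v)).continuousAt
      have hl : Continuous fun ε : ℝ => (v : ℂ) + ε * Complex.I + (Real.pi / 2 : ℝ) * Complex.I := by
        fun_prop
      have h0 := hl.tendsto 0
      simp only [Complex.ofReal_zero, zero_mul, add_zero] at h0
      exact (hc.tendsto.comp h0).mono_left nhdsWithin_le_nhds
    · exact ((tendsto_psi_upper_edge hv).pow (2 * p)).const_mul _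

/-- `Im ((π - i s) ^ (2 p)) / (2 p)!`. -/
noncomputable def edgePoly (p : ℕ) (s : ℝ) : ℝ :=
  ((2 * p).factorial : ℝ)⁻¹ * (((Real.pi : ℝ) - Complex.I * (s : ℝ)) ^ (2 * p) : ℂ).im

/-- The pairing does not depend on `ε`, so it equals its limit. The half-line `v < 0` drops out,
since `psi` is purely imaginary on that part of the edge and enters with an even power. -/
theorem im_pairing_eq {m p : ℕ} (hm : 1 ≤ m) (hp : 1 ≤ p) (l : ℕ) {ε : ℝ} (h0 : 0 < ε)
    (h1 : ε < Real.pi / 2) : (pairing (psiTail m l) (psiTail p 1) ε).im =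
      ∫ v in Set.Ioi (0 : ℝ), phiTail m l v * edgePoly p (logCoth v) := by
  have hlim := tendsto_im_pairing (stripDecay_psiTail hm l) hp
  have hconst : ∀ᶠ ε' : ℝ in 𝓝[>] 0, (pairing (psiTail m l) (psiTail p 1) ε').im =
      (pairing (psiTail m l) (psiTail p 1) ε).im := by
    filter_upwards [Ioo_mem_nhdsGT (show (0 : ℝ) < Real.pi / 2 by positivity)] with ε' hε'
    rw [pairing_eq (stripDecay_psiTail hm l) (stripDecay_psiTail hp 1) hε'.1 hε'.2 h0 h1]
  have heq := tendsto_nhds_unique (tendsto_const_nhds.congr' (hconst.mono fun _ h => h.symm)) hlim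
  have e : ∀ v : ℝ, (psiTail m l (v + (Real.pi / 2 : ℝ) * Complex.I) *
      (((2 * p).factorial : ℂ)⁻¹ * edge v ^ (2 * p))).im =
      phiTail m l v * (((2 * p).factorial : ℝ)⁻¹ * (edge v ^ (2 * p)).im) := by
    intro v
    rw [psiTail_midline hm, Complex.im_ofReal_mul, ← Complex.ofReal_natCast, ← Complex.ofReal_inv,
      Complex.im_ofReal_mul]
  rw [heq]
  simp_rw [e]
  rw [← MeasureTheory.setIntegral_eq_integral_of_forall_compl_eq_zero (s := Set.Ioi (0 : ℝ))]
  · refine MeasureTheory.setIntegral_congr_fun measurableSet_Ioi fun v hv => ?_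
    simp only [edgePoly]
    rw [edge, if_pos (Set.mem_Ioi.mp hv)]
  · intro v hv
    rw [im_edge_pow_of_neg p (not_lt.mp hv), mul_zero, mul_zero]

theorem integral_phiTail_symm {m p : ℕ} (hm : 1 ≤ m) (hp : 1 ≤ p) (l : ℕ) :
    ∫ v in Set.Ioi (0 : ℝ), phiTail m l v * edgePoly p (logCoth v) =
      ∫ v in Set.Ioi (0 : ℝ), phiTail p l v * edgePoly m (logCoth v) := by
  have h0 : 0 < Real.pi / 4 := by positivity
  have h1 : Real.pi / 4 < Real.pi / 2 := by linarith [Real.pi_pos]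
  rw [← im_pairing_eq hm hp l h0 h1, ← im_pairing_eq hp hm l h0 h1,
    pairing_psiTail_symm hm hp l h0 h1]

/-! ### Integral representation of the weighted sums -/

/-- The functions dual to `chainFun` in the repeated integration by parts. -/
noncomputable def dualFun (m l j : ℕ) (v : ℝ) : ℝ :=
  if j < l then phiTail m (l - j + 1) v
  else (-1) ^ (2 * m + l - j) * (phi v ^ (2 * m + l - j) / ((2 * m + l - j).factorial : ℝ))

theorem hasDerivAt_dualFun {m : ℕ} (hm : 1 ≤ m) {l j : ℕ} (hj : j < 2 * m + l) (v : ℝ) :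
    HasDerivAt (dualFun m l j) (-(rate l j v * dualFun m l (j + 1) v)) v := by
  rcases lt_or_ge j l with h | h
  · have e : dualFun m l j = phiTail m (l - j + 1) := by
      funext v
      simp [dualFun, h]
    rw [e]
    refine (hasDerivAt_phiTail hm (l - j) v).congr_deriv ?_
    rw [rate, if_pos h, one_mul, dualFun]
    split_ifs with h2
    · rw [show l - (j + 1) + 1 = l - j by omega]
    -- The two branches of `dualFun` meet here: the sign `(-1)^(2m)` is 1, because the number of
    -- forms `-du/cosh u` is even.
    · have h3 : j + 1 = l := by omega
      rw [show l - j = 1 by omega, phiTail_one, h3, Nat.add_sub_cancel, pow_mul]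
      norm_num
  · obtain ⟨k, hk⟩ : ∃ k, 2 * m + l - j = k + 1 := ⟨2 * m + l - j - 1, by omega⟩
    have e : dualFun m l j = fun v => (-1) ^ (k + 1) * (phi v ^ (k + 1) / ((k + 1).factorial : ℝ)) := by
      funext v
      simp only [dualFun]
      rw [if_neg (not_lt.mpr h), hk]
    rw [e]
    refine ((((hasDerivAt_phi v).pow (k + 1)).div_const _).const_mul _).congr_deriv ?_
    rw [rate, if_neg (not_lt.mpr h), dualFun, if_neg (by omega),
      show 2 * m + l - (j + 1) = k by omega, Nat.factorial_succ, Nat.add_sub_cancel]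
    have h2 : (k.factorial : ℝ) ≠ 0 := Nat.cast_ne_zero.mpr (Nat.factorial_ne_zero k)
    have h3 : (k : ℝ) + 1 ≠ 0 := Nat.cast_add_one_ne_zero k
    have h4 := (Real.cosh_pos v).ne'
    push_cast
    field_simp
    ring

theorem dualFun_last (m l : ℕ) (v : ℝ) : dualFun m l (2 * m + l) v = 1 := by
  simp [dualFun]

theorem rate_mul_dualFun_one {m : ℕ} (hm : 1 ≤ m) (l : ℕ) (v : ℝ) :
    rate l 0 v * dualFun m l 1 v = phiTail m l v := by
  rcases l with _ | _ | l
  · rw [phiTail_zero, rate, if_neg (lt_irrefl 0), dualFun, if_neg (by omega), add_zero,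
      Odd.neg_one_pow ⟨m - 1, by omega⟩]
    ring
  · rw [phiTail_one, rate, if_pos (by omega), dualFun, if_neg (by omega), zero_add,
      Nat.add_sub_cancel, pow_mul]
    norm_num
  · rw [rate, if_pos (by omega), dualFun, if_pos (by omega), one_mul]
    rfl

theorem exists_abs_phi_pow_le (k : ℕ) : ∃ C, ∀ v, |phi v ^ (k + 1)| ≤ C * Real.exp (-v) := by
  obtain ⟨C, hC⟩ := exists_abs_re_midline_le (stripDecay_psi.pow_succ k)
  refine ⟨C, fun v => ?_⟩
  have := hC v
  rwa [psi_midline, ← Complex.ofReal_pow, Complex.ofReal_re] at this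

theorem exists_abs_dualFun_le {m : ℕ} (hm : 1 ≤ m) {l j : ℕ} (hj : j < 2 * m + l) :
    ∃ C, ∀ v, |dualFun m l j v| ≤ C * Real.exp (-v) := by
  rcases lt_or_ge j l with h | h
  · obtain ⟨C, hC⟩ := exists_abs_re_midline_le (stripDecay_psiTail hm (l - j + 1))
    refine ⟨C, fun v => ?_⟩
    rw [dualFun, if_pos h]
    exact hC v
  · obtain ⟨k, hk⟩ : ∃ k, 2 * m + l - j = k + 1 := ⟨2 * m + l - j - 1, by omega⟩
    obtain ⟨C, hC⟩ := exists_abs_phi_pow_le k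
    refine ⟨C / ((k + 1).factorial : ℝ), fun v => ?_⟩
    rw [dualFun, if_neg (not_lt.mpr h), hk, abs_mul, abs_pow, abs_neg, abs_one, one_pow, one_mul,
      abs_div, Nat.abs_cast, div_mul_eq_mul_div]
    have := hC v
    gcongr

/-- The combination of chain functions and their duals whose derivative telescopes. -/
noncomputable def thetaFun (m l e : ℕ) (v : ℝ) : ℝ :=
  ∑ j ∈ Finset.range (2 * m + l), dualFun m l (j + 1) v * chainFun l (j + 1) e v

/-- The rate lowering the chain at one level also governs the derivative of its dual, with the
opposite sign. The products telescope, and only the bottom term remains, where the chain is a pure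
power of `logCoth`. -/
theorem hasDerivAt_thetaFun {m : ℕ} (hm : 1 ≤ m) (l e : ℕ) {v : ℝ} (hv : 0 < v) :
    HasDerivAt (thetaFun m l e) (phiTail m l v * (logCoth v ^ e / (e.factorial : ℝ))) v := by
  -- The value 0 at `j = 2m + l` reflects that the last dual function is constant.
  set D : ℕ → ℝ := fun j =>
    if j < 2 * m + l then rate l j v * dualFun m l (j + 1) v * chainFun l j e v else 0 with hD
  have hterm : ∀ j ∈ Finset.range (2 * m + l),
      HasDerivAt (fun v => dualFun m l (j + 1) v * chainFun l (j + 1) e v) (D j - D (j + 1)) v := by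
    intro j hj
    rw [Finset.mem_range] at hj
    rcases lt_or_ge (j + 1) (2 * m + l) with h | h
    · refine ((hasDerivAt_dualFun hm h v).mul (hasDerivAt_chainFun l j e hv)).congr_deriv ?_
      simp only [hD, if_pos hj, if_pos h]
      ring
    · have h2 : j + 1 = 2 * m + l := by omega
      have e1 : (fun v => dualFun m l (j + 1) v * chainFun l (j + 1) e v) =
          chainFun l (j + 1) e := by
        funext w
        rw [h2, dualFun_last, one_mul]
      rw [e1]
      refine (hasDerivAt_chainFun l j e hv).congr_deriv ?_
      simp only [hD, if_pos hj, if_neg (not_lt.mpr h)]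
      rw [h2, dualFun_last]
      ring
  refine (HasDerivAt.fun_sum hterm).congr_deriv ?_
  rw [Finset.sum_range_sub']
  simp only [hD, if_neg (lt_irrefl _), if_pos (show 0 < 2 * m + l by omega)]
  rw [zero_add, rate_mul_dualFun_one hm, chainFun_zero, sub_zero]

theorem tendsto_thetaFun_zero {m : ℕ} (hm : 1 ≤ m) (l e : ℕ) :
    Tendsto (thetaFun m l e) (𝓝[>] 0) (𝓝 0) := by
  have h : ∀ j ∈ Finset.range (2 * m + l), Tendsto
      (fun v => dualFun m l (j + 1) v * chainFun l (j + 1) e v) (𝓝[>] 0) (𝓝 0) := by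
    intro j hj
    rw [Finset.mem_range] at hj
    have hc : ContinuousAt (dualFun m l (j + 1)) 0 := by
      rcases lt_or_ge (j + 1) (2 * m + l) with h | h
      · exact (hasDerivAt_dualFun hm h 0).continuousAt
      · rw [show j + 1 = 2 * m + l by omega]
        have : dualFun m l (2 * m + l) = fun _ => 1 := funext fun v => dualFun_last m l v
        rw [this]
        exact continuousAt_const
    have := (hc.tendsto.mono_left (nhdsWithin_le_nhds (s := Set.Ioi 0))).mul
      (tendsto_chainFun_zero l j e)
    rwa [mul_zero] at this
  have := tendsto_finsetSum _ h
  rw [Finset.sum_const_zero] at this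
  exact this

/-- All terms but the last pair an exponentially decaying dual with a polynomially growing chain;
the last is the chain of full depth itself. -/
theorem tendsto_thetaFun_atTop {m : ℕ} (hm : 1 ≤ m) (l e : ℕ) :
    Tendsto (thetaFun m l e) atTop (𝓝 (weightedSum l (e + (2 * m + l)) (2 * m + l))) := by
  obtain ⟨k, hk⟩ : ∃ k, 2 * m + l = k + 1 := ⟨2 * m + l - 1, by omega⟩
  have h : ∀ j ∈ Finset.range k, Tendsto
      (fun v => dualFun m l (j + 1) v * chainFun l (j + 1) e v) atTop (𝓝 0) := by
    intro j hj
    rw [Finset.mem_range] at hj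
    obtain ⟨C, hC⟩ := exists_abs_dualFun_le hm (l := l) (j := j + 1) (by omega)
    obtain ⟨D, hD0, hD⟩ := abs_chainFun_le l (j + 1) e
    have hlim := (Real.tendsto_pow_mul_exp_neg_atTop_nhds_zero (j + 1)).const_mul (C * D)
    rw [mul_zero] at hlim
    refine squeeze_zero_norm' ?_ hlim
    filter_upwards [eventually_ge_atTop 1] with v hv
    rw [norm_mul, Real.norm_eq_abs, Real.norm_eq_abs]
    refine (mul_le_mul (hC v) (hD v hv) (abs_nonneg _) ((abs_nonneg _).trans (hC v))).trans
      (le_of_eq ?_)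
    ring
  have h2 := (tendsto_finsetSum _ h).add (tendsto_chainFun_atTop (l := l) (r := 2 * m + l)
    (by omega) e)
  rw [Finset.sum_const_zero, zero_add] at h2
  refine h2.congr fun v => ?_
  rw [thetaFun, hk, Finset.sum_range_succ, ← hk, dualFun_last, one_mul]

/-- The value of `f` at the endpoint is irrelevant; it is replaced by the one-sided limit to obtain
continuity there. -/
theorem integral_Ioi_of_hasDerivAt_of_tendsto_nhdsGT {f f' : ℝ → ℝ} {a b c : ℝ}
    (hd : ∀ x ∈ Set.Ioi a, HasDerivAt f (f' x) x) (hi : MeasureTheory.IntegrableOn f' (Set.Ioi a))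
    (ha : Tendsto f (𝓝[>] a) (𝓝 b)) (ht : Tendsto f atTop (𝓝 c)) :
    ∫ x in Set.Ioi a, f' x = c - b := by
  have hne : ∀ x ∈ Set.Ioi a, Function.update f a b =ᶠ[𝓝 x] f := fun x hx => by
    filter_upwards [isOpen_Ioi.mem_nhds hx] with y hy
    exact Function.update_of_ne (ne_of_gt hy) _ _
  have h := MeasureTheory.integral_Ioi_of_hasDerivAt_of_tendsto (f := Function.update f a b)
    (a := a) (m := c) (f' := f') ?_ (fun x hx => (hd x hx).congr_of_eventuallyEq (hne x hx)) hi ?_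
  · rwa [Function.update_self] at h
  · rw [continuousWithinAt_update_same]
    refine ha.mono_left (nhdsWithin_mono _ fun x hx => ?_)
    exact lt_of_le_of_ne hx.1 (Ne.symm hx.2)
  · refine ht.congr' ?_
    filter_upwards [eventually_gt_atTop a] with x hx
    exact (Function.update_of_ne (ne_of_gt hx) _ _).symm

theorem integrableOn_phiTail_mul_logCoth_pow {m : ℕ} (hm : 1 ≤ m) (l e : ℕ) :
    MeasureTheory.IntegrableOn (fun v => phiTail m l v * (logCoth v ^ e / (e.factorial : ℝ)))
      (Set.Ioi 0) := by
  obtain ⟨C, hC⟩ := exists_abs_re_midline_le (stripDecay_psiTail hm l)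
  refine MeasureTheory.Integrable.mono'
    ((integrableOn_logCoth_pow_mul_exp e).const_mul (C / (e.factorial : ℝ))) ?_ ?_
  · refine ContinuousOn.aestronglyMeasurable ?_ measurableSet_Ioi
    exact (continuous_phiTail hm l).continuousOn.mul ((continuousOn_logCoth.pow e).div_const _)
  · refine (MeasureTheory.ae_restrict_iff' measurableSet_Ioi).mpr
      (Eventually.of_forall fun v hv => ?_)
    have hs := logCoth_pos hv
    rw [norm_mul, Real.norm_eq_abs, Real.norm_of_nonneg (by positivity)]
    calc _ ≤ C * Real.exp (-v) * (logCoth v ^ e / (e.factorial : ℝ)) := by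
          gcongr
          exact hC v
      _ = _ := by ring

theorem weightedSum_eq_integral {m : ℕ} (hm : 1 ≤ m) (l e : ℕ) :
    weightedSum l (e + (2 * m + l)) (2 * m + l) =
      ∫ v in Set.Ioi (0 : ℝ), phiTail m l v * (logCoth v ^ e / (e.factorial : ℝ)) := by
  rw [integral_Ioi_of_hasDerivAt_of_tendsto_nhdsGT
    (fun v hv => hasDerivAt_thetaFun hm l e hv) (integrableOn_phiTail_mul_logCoth_pow hm l e)
    (tendsto_thetaFun_zero hm l e) (tendsto_thetaFun_atTop hm l e), sub_zero]

/-! ### Expansion of the edge polynomial and conclusion -/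

theorem sum_range_eq_sum_odd {f : ℕ → ℝ} (hf : ∀ j, f (2 * j) = 0) (n : ℕ) :
    ∑ i ∈ Finset.range (2 * n + 1), f i = ∑ j ∈ Finset.Icc 1 n, f (2 * j - 1) := by
  induction n with
  | zero => simpa using hf 0
  | succ n ih =>
    rw [Finset.sum_Icc_succ_top (by omega), ← ih, show 2 * (n + 1) + 1 = 2 * n + 1 + 1 + 1 by ring,
      Finset.sum_range_succ, Finset.sum_range_succ, show 2 * n + 1 + 1 = 2 * (n + 1) by ring, hf,
      show 2 * (n + 1) - 1 = 2 * n + 1 by omega, add_zero]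

theorem im_sub_I_mul_pow (a s : ℝ) (n : ℕ) :
    (((a : ℂ) - Complex.I * s) ^ (2 * n)).im =
      ∑ j ∈ Finset.Icc 1 n, (-1) ^ j * s ^ (2 * j - 1) * a ^ (2 * (n - j) + 1) *
        ((2 * n).choose (2 * j - 1) : ℝ) := by
  have hI : (-Complex.I) ^ 2 = ((-1 : ℝ) : ℂ) := by simp
  have hterm : ∀ i, ((-Complex.I * s) ^ i * (a : ℂ) ^ (2 * n - i) * ((2 * n).choose i : ℂ)).im =
      ((-Complex.I) ^ i).im * (s ^ i * a ^ (2 * n - i) * ((2 * n).choose i : ℝ)) := by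
    intro i
    rw [← Complex.im_mul_ofReal]
    push_cast
    congr 1
    ring
  rw [sub_eq_neg_add, ← neg_mul, add_pow, Complex.im_sum, Finset.sum_congr rfl fun i _ => hterm i,
    sum_range_eq_sum_odd]
  · refine Finset.sum_congr rfl fun j hj => ?_
    rw [Finset.mem_Icc] at hj
    obtain ⟨k, rfl⟩ : ∃ k, j = k + 1 := ⟨j - 1, by omega⟩
    rw [show 2 * (k + 1) - 1 = 2 * k + 1 by omega,
      show 2 * n - (2 * k + 1) = 2 * (n - (k + 1)) + 1 by omega, pow_succ (-Complex.I), pow_mul, hI,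
      ← Complex.ofReal_pow, Complex.im_ofReal_mul, Complex.neg_im, Complex.I_im]
    ring
  · intro j
    rw [pow_mul, hI, ← Complex.ofReal_pow, Complex.ofReal_im, zero_mul]

/-- Only odd powers of `-i s` have an imaginary part. The binomial coefficient over `(2p)!` splits
into `1/(2j-1)!` and `1/(2(p-j)+1)!`, and the latter with `π^(2(p-j)+1)` gives `π α_{p-j}` up to
sign. -/
theorem edgePoly_eq (p : ℕ) (s : ℝ) :
    edgePoly p s = (-1) ^ p * Real.pi * ∑ j ∈ Finset.Icc 1 p,
      alphaCoeff (p - j) * (s ^ (2 * j - 1) / ((2 * j - 1).factorial : ℝ)) := by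
  unfold edgePoly
  rw [im_sub_I_mul_pow, Finset.mul_sum, Finset.mul_sum]
  refine Finset.sum_congr rfl fun j hj => ?_
  rw [Finset.mem_Icc] at hj
  rw [Nat.cast_choose ℝ (by omega : 2 * j - 1 ≤ 2 * p),
    show 2 * p - (2 * j - 1) = 2 * (p - j) + 1 by omega, alphaCoeff]
  have h1 : ((2 * p).factorial : ℝ) ≠ 0 := Nat.cast_ne_zero.mpr (Nat.factorial_ne_zero _)
  have h2 : (-1 : ℝ) ^ p * (-1) ^ (p - j) = (-1) ^ j := by
    rw [← pow_add, show p + (p - j) = 2 * (p - j) + j by omega, pow_add, pow_mul]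
    norm_num
  rw [← h2]
  field_simp
  ring

theorem sum_alphaCoeff_mul_weightedSum {m : ℕ} (hm : 1 ≤ m) (p l : ℕ) :
    (-1 : ℝ) ^ p * Real.pi * ∑ j ∈ Finset.Icc 1 p,
        alphaCoeff (p - j) * weightedSum l (2 * j + 2 * m + l - 1) (2 * m + l) =
      ∫ v in Set.Ioi (0 : ℝ), phiTail m l v * edgePoly p (logCoth v) := by
  have e : ∀ v, phiTail m l v * edgePoly p (logCoth v) = ∑ j ∈ Finset.Icc 1 p,
      ((-1 : ℝ) ^ p * Real.pi * alphaCoeff (p - j)) * (phiTail m l v *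
        (logCoth v ^ (2 * j - 1) / ((2 * j - 1).factorial : ℝ))) := by
    intro v
    rw [edgePoly_eq, Finset.mul_sum, Finset.mul_sum]
    exact Finset.sum_congr rfl fun j _ => by ring
  simp_rw [e]
  rw [MeasureTheory.integral_finsetSum _ fun j _ =>
    (integrableOn_phiTail_mul_logCoth_pow hm l (2 * j - 1)).const_mul _, Finset.mul_sum]
  refine Finset.sum_congr rfl fun j hj => ?_
  rw [Finset.mem_Icc] at hj
  rw [MeasureTheory.integral_const_mul, ← weightedSum_eq_integral hm,
    show 2 * j - 1 + (2 * m + l) = 2 * j + 2 * m + l - 1 by omega]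
  ring

theorem mainTheorem2 (m p l : ℕ) (hm : 1 ≤ m) (hp : 1 ≤ p) :
    (∀ (r : ℕ) (k : Fin r → ℕ), l < r → (∀ i, 1 ≤ k i) →
      Tendsto (amtvPartial k (barSigns l r)) atTop (𝓝 (amtv k (barSigns l r)))) ∧
    (-1 : ℝ) ^ m * ∑ j ∈ Finset.Icc 1 p,
        alphaCoeff (p - j) * weightedSum l (2 * j + 2 * m + l - 1) (2 * m + l) =
      (-1 : ℝ) ^ p * ∑ j ∈ Finset.Icc 1 m,
        alphaCoeff (m - j) * weightedSum l (2 * j + 2 * p + l - 1) (2 * p + l) := by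
  refine ⟨fun r k hr hk => ?_, ?_⟩
  · obtain ⟨r, rfl⟩ : ∃ r', r = r' + 1 := ⟨r - 1, by omega⟩
    exact tendsto_amtvPartial k hk _ (by simp [barSigns])
  · have h := integral_phiTail_symm hm hp l
    rw [← sum_alphaCoeff_mul_weightedSum hm, ← sum_alphaCoeff_mul_weightedSum hp] at h
    have hpm : (-1 : ℝ) ^ p * (-1) ^ p = 1 := by rw [← mul_pow]; norm_num
    have hmm : (-1 : ℝ) ^ m * (-1) ^ m = 1 := by rw [← mul_pow]; norm_num
    -- The symmetric integrals carry the signs `(-1)^p` and `(-1)^m`; multiplication by `(-1)^(m+p)`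
    -- exchanges them.
    apply mul_left_cancel₀ Real.pi_ne_zero
    set A := ∑ j ∈ Finset.Icc 1 p,
        alphaCoeff (p - j) * weightedSum l (2 * j + 2 * m + l - 1) (2 * m + l)
    set B := ∑ j ∈ Finset.Icc 1 m,
        alphaCoeff (m - j) * weightedSum l (2 * j + 2 * p + l - 1) (2 * p + l)
    linear_combination (-1 : ℝ) ^ m * (-1) ^ p * h - (-1 : ℝ) ^ m * Real.pi * A * hpm +
      (-1 : ℝ) ^ p * Real.pi * B * hmm
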